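/- Let $g, k_1^v, k_2^v, k_1^r > 0$ be arbitrary constants, let $\{e_1,e_2,e_3\}$ be the canonical basis of $\mathbb{R}^3$, let $S^2\subset\mathbb{R}^3$ be the unit sphere, and consider on $\mathbb{R}^3\times S^2$ the autonomous system (the error system of $\gamma$-Observer 2) $$\dot{\bar v} = g(e_3-\bar\gamma) - k_1^v\bar v + k_2^v\,\bar\gamma\times(\bar\gamma\times\bar v) + k_1^r\,\bar v\times(\bar v\times\bar\gamma),\qquad \dot{\bar\gamma} = -k_1^r\,\bar\gamma\times(\bar\gamma\times\bar v).$$ Then the following properties hold. 1. The system has exactly two equilibrium points, $(\bar v,\bar\gamma)=(0,e_3)$ and $(\bar v,\bar\gamma)=\left(\frac{2g}{k_1^v}e_3,-e_3\right)$; they are distinct and isolated. For every initial condition in $\mathbb{R}^3\times S^2$ there is a unique trajectory; it is defined for all $t\ge 0$, and it converges as $t\to\infty$ to one of these two equilibria. 2. The equilibrium $(0,e_3)$ is almost globally asymptotically stable, that is, it is Lyapunov stable, its basin of attraction is a neighbourhood of it, and the complement of this basin in $\mathbb{R}^3\times S^2$ has measure zero for the product of Lebesgue measure and the surface measure of $S^2$.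 It is also locally exponentially stable: there are $C,r,\delta>0$ such that every trajectory whose initial distance $d(0)$ to $(0,e_3)$ is less than $\delta$ has distance $d(t)\le C e^{-rt}d(0)$ to $(0,e_3)$ for all $t\ge 0$. 3. The equilibrium $\left(\frac{2g}{k_1^v}e_3,-e_3\right)$ is unstable, that is, not Lyapunov stable. -/

import Mathlib

open Set Filter Topology MeasureTheory

noncomputable section

namespace GammaObserver

/-- Euclidean three-space. -/
abbrev E3 : Type := EuclideanSpace ℝ (Fin 3)

/-- The unit sphere of Euclidean three-space. -/
abbrev S2 : Type := Metric.sphere (0 : E3) 1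

/-- The state space of the error system: velocity error and direction error. -/
abbrev ErrorState : Type := E3 × S2

/-- The cross product of Euclidean three-space. -/
def cross (u v : E3) : E3 := WithLp.toLp 2 (crossProduct u.ofLp v.ofLp)

/-- The third vector of the canonical basis. -/
def e3 : E3 := EuclideanSpace.single 2 1

/-- The third vector of the canonical basis, as a point of the unit sphere. -/
def e3S : S2 := ⟨e3, by simp [e3]⟩

/-- The first component of the right-hand side of the error system:
`g (e3 - γ) - k1v v + k2v γ × (γ × v) + k1r v × (v × γ)`. -/
def velocityField (g k1v k2v k1r : ℝ) (v γ : E3) : E3 :=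
  g • (e3 - γ) - k1v • v + k2v • cross γ (cross γ v) + k1r • cross v (cross v γ)

/-- The second component of the right-hand side of the error system: `-k1r γ × (γ × v)`. -/
def directionField (k1r : ℝ) (v γ : E3) : E3 :=
  -(k1r • cross γ (cross γ v))

/-- `ξ` solves the error system on the time set `I` (an interval `[0, T]` or `[0, ∞)`), with
one-sided derivatives at the end points. The values of `ξ` outside `I` play no role. -/
def IsSolutionOn (g k1v k2v k1r : ℝ) (I : Set ℝ) (ξ : ℝ → ErrorState) : Prop :=
  ∀ t ∈ I,
    HasDerivWithinAt (fun s => (ξ s).1)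
      (velocityField g k1v k2v k1r (ξ t).1 ((ξ t).2 : E3)) I t ∧
    HasDerivWithinAt (fun s => ((ξ s).2 : E3))
      (directionField k1r (ξ t).1 ((ξ t).2 : E3)) I t

/-- The trajectories of the error system: the solutions on `[0, ∞)`. -/
def trajectories (g k1v k2v k1r : ℝ) : Set (ℝ → ErrorState) :=
  {ξ | IsSolutionOn g k1v k2v k1r (Ici 0) ξ}

/-- The equilibrium points of the error system: the states where the right-hand side vanishes. -/
def equilibria (g k1v k2v k1r : ℝ) : Set ErrorState :=
  {p | velocityField g k1v k2v k1r p.1 (p.2 : E3) = 0 ∧ directionField k1r p.1 (p.2 : E3) = 0}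

/-- The desired equilibrium `(0, e3)`. -/
def desired : ErrorState := (0, e3S)

/-- The undesired equilibrium `((2 g / k1v) e3, -e3)`. -/
def undesired (g k1v : ℝ) : ErrorState := ((2 * g / k1v) • e3, -e3S)

/-- The product of Lebesgue measure on `ℝ³` and of the surface measure on the unit sphere. -/
def stateMeasure : Measure ErrorState :=
  (volume : Measure E3).prod (volume : Measure E3).toSphere

section Stability

variable {X : Type*} [PseudoMetricSpace X]

/-- (Lyapunov) stability of the point `x` for the system with the trajectories `Φ`. -/
def IsStable (Φ : Set (ℝ → X)) (x : X) : Prop :=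
  ∀ ε > 0, ∃ δ > 0, ∀ ξ ∈ Φ, dist (ξ 0) x < δ → ∀ t ≥ 0, dist (ξ t) x < ε

/-- The set of the initial conditions from which a trajectory converges to `x`. -/
def basin (Φ : Set (ℝ → X)) (x : X) : Set X :=
  {p | ∃ ξ ∈ Φ, ξ 0 = p ∧ Tendsto ξ atTop (𝓝 x)}

/-- Asymptotic stability: stability together with local attractivity. -/
def IsAsymptoticallyStable (Φ : Set (ℝ → X)) (x : X) : Prop :=
  IsStable Φ x ∧ basin Φ x ∈ 𝓝 x

/-- Almost-global asymptotic stability: asymptotic stability, with a domain of attraction whose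
complement has measure zero. -/
def IsAlmostGloballyAsymptoticallyStable [MeasurableSpace X] (μ : Measure X)
    (Φ : Set (ℝ → X)) (x : X) : Prop :=
  IsAsymptoticallyStable Φ x ∧ μ (basin Φ x)ᶜ = 0

/-- Local exponential stability. -/
def IsLocallyExponentiallyStable (Φ : Set (ℝ → X)) (x : X) : Prop :=
  ∃ C > 0, ∃ r > 0, ∃ δ > 0, ∀ ξ ∈ Φ, dist (ξ 0) x < δ →
    ∀ t ≥ 0, dist (ξ t) x ≤ C * Real.exp (-r * t) * dist (ξ 0) x

end Stability

end GammaObserver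

end

/-! ### Differential inequalities on a half-line -/

/-! The system hides a damped spherical pendulum. With `c = γ₃`, `s = γ·v`, `W = |γ × v|²`, `z = v₃
- s c`, `L = (γ × v)₃` and `K = k1v + k2v`, the dynamics closes up (`isReducedSolution`): `s` obeys
a stable linear equation driven by `c`, the spin satisfies `L' = -K L`, and the energy `E = (r/2) W
+ g (1 - c)`, where `r = k1r`, satisfies `E' = -r K W`.

Convergence: Barbalat's lemma applied to `E` gives `W → 0`, hence `z → 0`; applied to `z`, it gives
`z' → 0`, which forces `c² → 1`. As `E` converges, so does `c`, to `1` or `-1`; then `s` follows,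
and the state tends to one of the two equilibria.

Local exponential stability: `E` dissipates only `W`, so it is corrected to `E - ε z + η s²`, which
decays exponentially where `E < g` initially (`lyapunov_le`). Stability and local attractivity
follow.

Almost global attraction: a trajectory with `c → -1` must have zero spin (`spin_eq_zero`), so the
complement of the basin lies in `{spin = 0}`, which is null by Fubini. The stable manifold itself
need not be constructed.

Instability: arbitrarily near the undesired equilibrium there are states of energy below `2 g`, its
own energy. Their trajectories cannot return to it, so they go to the desired equilibrium, far away.

Global existence comes from cutting the vector field off outside a bounded forward-invariant set. -/

lemma antitoneOn_Ici_of_hasDerivWithinAt {f f' : ℝ → ℝ} {a : ℝ}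
    (hf : ∀ t ∈ Ici a, HasDerivWithinAt f (f' t) (Ici a) t) (hf' : ∀ t ∈ Ici a, f' t ≤ 0) :
    AntitoneOn f (Ici a) :=
  antitoneOn_of_hasDerivWithinAt_nonpos (convex_Ici a)
    (fun t ht => (hf t ht).continuousWithinAt)
    (fun t ht => (hf t (interior_subset ht)).mono interior_subset)
    (fun t ht => hf' t (interior_subset ht))

/-- Grönwall's argument: `f t * exp (c (t - a))` is nonincreasing. The signs of `f` and `c` are
arbitrary. -/
lemma le_mul_exp_of_hasDerivWithinAt_le {f f' : ℝ → ℝ} {a c : ℝ}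
    (hf : ∀ t ∈ Ici a, HasDerivWithinAt f (f' t) (Ici a) t)
    (hf' : ∀ t ∈ Ici a, f' t ≤ -c * f t) {t : ℝ} (ht : a ≤ t) :
    f t ≤ f a * Real.exp (-c * (t - a)) := by
  have hd : ∀ s ∈ Ici a, HasDerivWithinAt (fun s => f s * Real.exp (c * (s - a)))
      (f' s * Real.exp (c * (s - a)) + f s * (Real.exp (c * (s - a)) * c)) (Ici a) s := by
    intro s hs
    have he : HasDerivAt (fun s => Real.exp (c * (s - a))) (Real.exp (c * (s - a)) * c) s := by
      simpa using (((hasDerivAt_id s).sub_const a).const_mul c).exp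
    exact (hf s hs).mul he.hasDerivWithinAt
  have hanti := antitoneOn_Ici_of_hasDerivWithinAt hd fun s hs => by
    nlinarith [hf' s hs, Real.exp_pos (c * (s - a))]
  have h := hanti self_mem_Ici ht ht
  simp only [sub_self, mul_zero, Real.exp_zero, mul_one] at h
  calc f t = f t * Real.exp (c * (t - a)) * Real.exp (-c * (t - a)) := by
        rw [mul_assoc, ← Real.exp_add]; simp
    _ ≤ _ := by gcongr

lemma tendsto_of_antitoneOn_Ici {f : ℝ → ℝ} {a b : ℝ} (hf : AntitoneOn f (Ici a))
    (hb : ∀ t ∈ Ici a, b ≤ f t) :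
    ∃ l, Tendsto f atTop (𝓝 l) ∧ ∀ t ∈ Ici a, l ≤ f t := by
  have hanti : Antitone fun t => f (max a t) := fun x y hxy =>
    hf (mem_Ici.2 (le_max_left a x)) (mem_Ici.2 (le_max_left a y)) (max_le_max le_rfl hxy)
  have hbdd : BddBelow (range fun t => f (max a t)) :=
    ⟨b, by rintro _ ⟨t, rfl⟩; exact hb _ (mem_Ici.2 (le_max_left a t))⟩
  have hlim := tendsto_atTop_ciInf hanti hbdd
  refine ⟨_, hlim.congr' ?_, fun t ht => ?_⟩
  · filter_upwards [eventually_ge_atTop a] with t ht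
    rw [max_eq_right ht]
  · have := ciInf_le hbdd t
    rwa [max_eq_right ht] at this

/-- **Barbalat's lemma**: if a function converges at infinity and its derivative `f'` has a
bounded derivative, then `f'` tends to zero. -/
lemma tendsto_deriv_zero_of_tendsto {f f' f'' : ℝ → ℝ} {a l B : ℝ} (hl : Tendsto f atTop (𝓝 l))
    (hf : ∀ t ∈ Ici a, HasDerivWithinAt f (f' t) (Ici a) t)
    (hf' : ∀ t ∈ Ici a, HasDerivWithinAt f' (f'' t) (Ici a) t)
    (hB : ∀ t ∈ Ici a, |f'' t| ≤ B) : Tendsto f' atTop (𝓝 0) := by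
  have hB0 : 0 ≤ B := (abs_nonneg _).trans (hB a self_mem_Ici)
  rw [Metric.tendsto_atTop]
  intro ε hε
  -- On a window of length `δ` the derivative varies by at most `B δ ≤ ε / 2`; the `+ 1` covers `B =
  -- 0`.
  set δ := ε / (2 * (B + 1)) with hδ
  have hδ0 : 0 < δ := by positivity
  have hBδ : B * δ ≤ ε / 2 := by
    rw [hδ, mul_div_assoc', div_le_div_iff₀ (by positivity) two_pos]
    nlinarith
  have hdiff : Tendsto (fun t => f (t + δ) - f t) atTop (𝓝 0) := by
    simpa using (hl.comp (tendsto_atTop_add_const_right _ δ tendsto_id)).sub hl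
  obtain ⟨T, hT⟩ := Metric.tendsto_atTop.1 hdiff (δ * (ε / 2)) (by positivity)
  refine ⟨max a T, fun t ht => ?_⟩
  have hta : a ≤ t := (le_max_left _ _).trans ht
  have hlip : ∀ x ∈ Ici a, ∀ y ∈ Ici a, |f' y - f' x| ≤ B * |y - x| := fun x hx y hy =>
    (convex_Ici a).norm_image_sub_le_of_norm_hasDerivWithin_le hf' hB hx hy
  have hmem : ∀ x ∈ Icc t (t + δ), a ≤ x := fun x hx => hta.trans hx.1
  -- The mean slope over the window is eventually below `ε / 2`, so `f'` is that small somewhere in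
  -- the window, hence below `ε` at `t`.
  obtain ⟨τ, hτ, hτe⟩ := exists_hasDerivAt_eq_slope f f' (show t < t + δ by linarith)
    (fun x hx => ((hf x (hmem x hx)).continuousWithinAt).mono hmem)
    (fun x hx => (hf x (hmem x (Ioo_subset_Icc_self hx))).hasDerivAt
      (Ici_mem_nhds (hta.trans_lt hx.1)))
  have h1 := hT t ((le_max_right _ _).trans ht)
  rw [Real.dist_eq, sub_zero] at h1 ⊢
  rw [add_sub_cancel_left, eq_div_iff hδ0.ne'] at hτe
  rw [← hτe, abs_mul, abs_of_pos hδ0, mul_comm] at h1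
  have h2 := lt_of_mul_lt_mul_left h1 hδ0.le
  have h3 := hlip t hta τ (hta.trans hτ.1.le)
  have h4 : |τ - t| ≤ δ := by
    rw [abs_of_pos (sub_pos.2 hτ.1)]; linarith [hτ.2]
  have h5 : |f' t| ≤ |f' τ| + |f' τ - f' t| := by
    have := abs_sub_abs_le_abs_sub (f' t) (f' τ)
    rw [abs_sub_comm] at this
    linarith
  nlinarith [mul_le_mul_of_nonneg_left h4 hB0]

/-- A stable scalar linear equation with vanishing input. -/
lemma tendsto_zero_of_hasDerivWithinAt_linear {y u : ℝ → ℝ} {a k : ℝ} (hk : 0 < k)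
    (hy : ∀ t ∈ Ici a, HasDerivWithinAt y (-k * y t + u t) (Ici a) t)
    (hu : Tendsto u atTop (𝓝 0)) : Tendsto y atTop (𝓝 0) := by
  -- A one-sided bound suffices, being applied to both `y` and `-y`. Once `u < k ε / 2`, the
  -- function `y - ε / 2` satisfies `f' ≤ -k f`.
  have upper : ∀ y u : ℝ → ℝ,
      (∀ t ∈ Ici a, HasDerivWithinAt y (-k * y t + u t) (Ici a) t) →
      Tendsto u atTop (𝓝 0) → ∀ ε > 0, ∀ᶠ t in atTop, y t < ε := by
    intro y u hy hu ε hε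
    have h1 : ∀ᶠ t in atTop, u t < k * (ε / 2) := hu.eventually_lt_const (by positivity)
    obtain ⟨T, hT⟩ := eventually_atTop.1 (h1.and (eventually_ge_atTop a))
    have haT : a ≤ T := (hT T le_rfl).2
    have hd : ∀ t ∈ Ici T, HasDerivWithinAt (fun t => y t - ε / 2) (-k * y t + u t) (Ici T) t :=
      fun t ht => ((hy t (haT.trans ht)).mono (Ici_subset_Ici.2 haT)).sub_const _
    have hle := fun t (ht : T ≤ t) => le_mul_exp_of_hasDerivWithinAt_le (c := k) hd
      (fun s hs => by linarith [(hT s hs).1]) ht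
    have hlim : Tendsto (fun t => (y T - ε / 2) * Real.exp (-k * (t - T))) atTop (𝓝 0) := by
      have : Tendsto (fun t => -k * (t - T)) atTop atBot :=
        (tendsto_atTop_add_const_right _ (-T) tendsto_id).const_mul_atTop_of_neg (by linarith)
      simpa using (Real.tendsto_exp_atBot.comp this).const_mul (y T - ε / 2)
    filter_upwards [hlim.eventually_lt_const (half_pos hε), eventually_ge_atTop T] with t h2 h3
    linarith [hle t h3]
  rw [Metric.tendsto_nhds]
  intro ε hε
  have hneg : ∀ t ∈ Ici a,
      HasDerivWithinAt (fun t => -y t) (-k * (-y t) + -u t) (Ici a) t := fun t ht => by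
    convert! (hy t ht).neg using 1
    ring
  filter_upwards [upper y u hy hu ε hε,
    upper (fun t => -y t) (fun t => -u t) hneg (by simpa using hu.neg) ε hε] with t h1 h2
  rw [Real.dist_eq, sub_zero, abs_lt]
  constructor <;> linarith

namespace GammaObserver

/-! ### The reduced system -/

/-- The scalar system satisfied along the error trajectories by the height `c = γ₃`, the axial
velocity `s = ⟪γ, v⟫`, the squared planar velocity `W = |γ × v|²`, the climb rate
`z = v₃ - s c` and the spin `L = (γ × v)₃`. It describes a spherical pendulum with friction
coefficient `K`, together with a stable cascade in `s`. -/
structure IsReducedSolution (g k K r : ℝ) (c s W z L : ℝ → ℝ) : Prop where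
  height : ∀ t ∈ Ici (0 : ℝ), HasDerivWithinAt c (r * z t) (Ici 0) t
  axial : ∀ t ∈ Ici (0 : ℝ), HasDerivWithinAt s (-k * s t + -(g * (1 - c t))) (Ici 0) t
  planar : ∀ t ∈ Ici (0 : ℝ), HasDerivWithinAt W (2 * g * z t - 2 * K * W t) (Ici 0) t
  climb : ∀ t ∈ Ici (0 : ℝ),
    HasDerivWithinAt z (-r * W t * c t + g * (1 - c t ^ 2) - K * z t) (Ici 0) t
  spin : ∀ t ∈ Ici (0 : ℝ), HasDerivWithinAt L (-K * L t) (Ici 0) t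
  planar_nonneg : ∀ t, 0 ≤ W t
  height_sq_le : ∀ t, c t ^ 2 ≤ 1
  gram : ∀ t, z t ^ 2 + L t ^ 2 = W t * (1 - c t ^ 2)

namespace IsReducedSolution

variable {g k K r : ℝ} {c s W z L : ℝ → ℝ}

lemma energy_hasDerivWithinAt (h : IsReducedSolution g k K r c s W z L) :
    ∀ t ∈ Ici (0 : ℝ), HasDerivWithinAt (fun t => r / 2 * W t + g * (1 - c t))
      (-(r * K) * W t) (Ici 0) t := fun t ht => by
  convert! ((h.planar t ht).const_mul (r / 2)).add
    (((h.height t ht).const_sub 1).const_mul g) using 1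
  ring

lemma height_le (h : IsReducedSolution g k K r c s W z L) (t : ℝ) : c t ≤ 1 :=
  (abs_le.1 ((sq_le_one_iff_abs_le_one _).1 (h.height_sq_le t))).2

lemma neg_one_le_height (h : IsReducedSolution g k K r c s W z L) (t : ℝ) : -1 ≤ c t :=
  (abs_le.1 ((sq_le_one_iff_abs_le_one _).1 (h.height_sq_le t))).1

lemma climb_sq_le (h : IsReducedSolution g k K r c s W z L) (t : ℝ) :
    z t ^ 2 ≤ W t * (1 - c t ^ 2) := by
  nlinarith [h.gram t, sq_nonneg (L t)]

lemma climb_sq_le_planar (h : IsReducedSolution g k K r c s W z L) (t : ℝ) :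
    z t ^ 2 ≤ W t := by
  nlinarith [h.climb_sq_le t, mul_nonneg (h.planar_nonneg t) (sq_nonneg (c t))]

section Convergence

variable (hg : 0 < g) (hk : 0 < k) (hK : 0 < K) (hr : 0 < r)
include hr hK

lemma energy_antitoneOn (h : IsReducedSolution g k K r c s W z L) :
    AntitoneOn (fun t => r / 2 * W t + g * (1 - c t)) (Ici 0) :=
  antitoneOn_Ici_of_hasDerivWithinAt h.energy_hasDerivWithinAt fun t _ => by
    have := mul_nonneg (mul_pos hr hK).le (h.planar_nonneg t)
    linarith

include hg

lemma exists_energy_limit (h : IsReducedSolution g k K r c s W z L) :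
    ∃ l, Tendsto (fun t => r / 2 * W t + g * (1 - c t)) atTop (𝓝 l) ∧
      ∀ t ∈ Ici (0 : ℝ), l ≤ r / 2 * W t + g * (1 - c t) :=
  tendsto_of_antitoneOn_Ici (b := 0) (h.energy_antitoneOn hK hr) fun t _ => by
    have h1 := h.planar_nonneg t
    have h2 : 0 ≤ 1 - c t := sub_nonneg.2 (h.height_le t)
    positivity

lemma exists_planar_bound (h : IsReducedSolution g k K r c s W z L) :
    ∃ B, 0 ≤ B ∧ ∀ t ∈ Ici (0 : ℝ), W t ≤ B := by
  refine ⟨(r / 2 * W 0 + g * (1 - c 0)) / (r / 2), ?_, fun t ht => ?_⟩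
  · have h1 := h.planar_nonneg 0
    have h2 : 0 ≤ 1 - c 0 := sub_nonneg.2 (h.height_le 0)
    positivity
  · rw [le_div_iff₀ (by positivity)]
    have h2 := h.energy_antitoneOn hK hr self_mem_Ici ht ht
    have h3 : 0 ≤ g * (1 - c t) := mul_nonneg hg.le (sub_nonneg.2 (h.height_le t))
    simp only at h2
    linarith

omit hg hK hr in
lemma abs_climb_le {B : ℝ} (h : IsReducedSolution g k K r c s W z L) {t : ℝ} (hB : W t ≤ B) :
    |z t| ≤ B + 1 :=
  abs_le_of_sq_le_sq (by nlinarith [h.climb_sq_le_planar t, h.planar_nonneg t])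
    (by linarith [h.planar_nonneg t])

/-- Barbalat's lemma for the energy, whose derivative is `-r K W`; the derivative of the latter is
bounded because `W` and `z` are. -/
lemma tendsto_planar (h : IsReducedSolution g k K r c s W z L) : Tendsto W atTop (𝓝 0) := by
  obtain ⟨l, hl, -⟩ := h.exists_energy_limit hg hK hr
  obtain ⟨B, hB0, hB⟩ := h.exists_planar_bound hg hK hr
  have hrK := mul_pos hr hK
  have := tendsto_deriv_zero_of_tendsto (B := r * K * (2 * g * (B + 1) + 2 * K * B)) hl
    h.energy_hasDerivWithinAt (fun t ht => (h.planar t ht).const_mul (-(r * K))) fun t ht => by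
      rw [abs_mul, abs_neg, abs_of_pos hrK]
      refine mul_le_mul_of_nonneg_left ((abs_sub _ _).trans (add_le_add ?_ ?_)) hrK.le
      · rw [abs_mul, abs_of_pos (by positivity : 0 < 2 * g)]
        exact mul_le_mul_of_nonneg_left (h.abs_climb_le (hB t ht)) (by positivity)
      · rw [abs_mul, abs_of_pos (by positivity : 0 < 2 * K), abs_of_nonneg (h.planar_nonneg t)]
        exact mul_le_mul_of_nonneg_left (hB t ht) (by positivity)
  have h2 := this.const_mul (-(r * K))⁻¹
  rw [mul_zero] at h2
  refine h2.congr fun t => ?_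
  rw [← mul_assoc, inv_mul_cancel₀ (by simpa using hrK.ne'), one_mul]

lemma tendsto_climb (h : IsReducedSolution g k K r c s W z L) : Tendsto z atTop (𝓝 0) := by
  have h1 : Tendsto (fun t => z t ^ 2) atTop (𝓝 0) :=
    squeeze_zero (fun t => sq_nonneg _) h.climb_sq_le_planar (h.tendsto_planar hg hK hr)
  have h2 := (Real.continuous_sqrt.tendsto 0).comp h1
  rw [Real.sqrt_zero] at h2
  refine squeeze_zero_norm (fun t => ?_) h2
  simp [Real.sqrt_sq_eq_abs]

/-- Barbalat's lemma again, now for `z`: in `z' → 0` the terms in `W` and `z` vanish, leaving `g (1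
- c²) → 0`. Most of the work is bounding `z''`. -/
lemma tendsto_height_sq (h : IsReducedSolution g k K r c s W z L) :
    Tendsto (fun t => c t ^ 2) atTop (𝓝 1) := by
  obtain ⟨B, hB0, hB⟩ := h.exists_planar_bound hg hK hr
  have hz := h.tendsto_climb hg hK hr
  have hW := h.tendsto_planar hg hK hr
  have hc : ∀ t, |c t| ≤ 1 := fun t => (sq_le_one_iff_abs_le_one _).1 (h.height_sq_le t)
  have hd : ∀ t ∈ Ici (0 : ℝ), HasDerivWithinAt
      (fun t => -r * W t * c t + g * (1 - c t ^ 2) - K * z t)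
      (-r * (2 * g * z t - 2 * K * W t) * c t + -r * W t * (r * z t)
        - 2 * g * c t * (r * z t)
        - K * (-r * W t * c t + g * (1 - c t ^ 2) - K * z t)) (Ici 0) t := fun t ht => by
    convert! ((((h.planar t ht).const_mul (-r)).mul (h.height t ht)).add
      ((((h.height t ht).pow 2).const_sub 1).const_mul g)).sub ((h.climb t ht).const_mul K) using 1
    push_cast
    ring
  have hlim := tendsto_deriv_zero_of_tendsto
    (B := r * (2 * g * (B + 1) + 2 * K * B) + r * B * (r * (B + 1)) + 2 * g * (r * (B + 1))
      + K * (r * B + g + K * (B + 1))) hz h.climb hd fun t ht => by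
    have hz' := h.abs_climb_le (hB t ht)
    have hW' : |W t| ≤ B := by rw [abs_of_nonneg (h.planar_nonneg t)]; exact hB t ht
    have hc' := hc t
    have hc2 : |1 - c t ^ 2| ≤ 1 := by
      rw [abs_le]; constructor <;> nlinarith [h.height_sq_le t, sq_nonneg (c t)]
    have e1 : |-r * (2 * g * z t - 2 * K * W t) * c t|
        ≤ r * (2 * g * (B + 1) + 2 * K * B) := by
      rw [abs_mul, abs_mul, abs_neg, abs_of_pos hr]
      have : |2 * g * z t - 2 * K * W t| ≤ 2 * g * (B + 1) + 2 * K * B := by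
        refine (abs_sub _ _).trans ?_
        rw [abs_mul, abs_mul (2 * K), abs_of_pos (by positivity : 0 < 2 * g),
          abs_of_pos (by positivity : 0 < 2 * K)]
        gcongr
      calc _ ≤ r * (2 * g * (B + 1) + 2 * K * B) * 1 := by gcongr
        _ = _ := mul_one _
    have e2 : |-r * W t * (r * z t)| ≤ r * B * (r * (B + 1)) := by
      rw [abs_mul, abs_mul, abs_mul, abs_neg, abs_of_pos hr]; gcongr
    have e3 : |2 * g * c t * (r * z t)| ≤ 2 * g * (r * (B + 1)) := by
      rw [abs_mul, abs_mul, abs_mul r, abs_of_pos hr, abs_of_pos (by positivity : 0 < 2 * g)]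
      calc _ ≤ 2 * g * 1 * (r * (B + 1)) := by gcongr
        _ = _ := by ring
    have e4 : |K * (-r * W t * c t + g * (1 - c t ^ 2) - K * z t)|
        ≤ K * (r * B + g + K * (B + 1)) := by
      rw [abs_mul, abs_of_pos hK]
      have f1 : |-r * W t * c t| ≤ r * B * 1 := by
        rw [abs_mul, abs_mul, abs_neg, abs_of_pos hr]; gcongr
      have f2 : |g * (1 - c t ^ 2)| ≤ g * 1 := by
        rw [abs_mul, abs_of_pos hg]; gcongr
      have f3 : |K * z t| ≤ K * (B + 1) := by
        rw [abs_mul, abs_of_pos hK]; gcongr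
      refine mul_le_mul_of_nonneg_left ((abs_sub _ _).trans (add_le_add
        ((abs_add_le _ _).trans (add_le_add ?_ ?_)) f3)) hK.le <;> linarith
    exact (abs_sub _ _).trans (add_le_add ((abs_sub _ _).trans (add_le_add
      ((abs_add_le _ _).trans (add_le_add e1 e2)) e3)) e4)
  have hWc : Tendsto (fun t => W t * c t) atTop (𝓝 0) :=
    squeeze_zero_norm (fun t => by
      rw [Real.norm_eq_abs, abs_mul, abs_of_nonneg (h.planar_nonneg t)]
      exact mul_le_of_le_one_right (h.planar_nonneg t) (hc t)) hW
  have := (((hlim.add (hWc.const_mul r)).add (hz.const_mul K)).const_mul g⁻¹).const_sub 1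
  simp only [mul_zero, add_zero, sub_zero] at this
  refine this.congr fun t => ?_
  field_simp
  ring

/-- The height converges to one of its two equilibrium values. -/
lemma tendsto_height (h : IsReducedSolution g k K r c s W z L) :
    Tendsto c atTop (𝓝 1) ∨ Tendsto c atTop (𝓝 (-1)) := by
  obtain ⟨l, hl, -⟩ := h.exists_energy_limit hg hK hr
  -- The limit of `c²` alone does not give convergence of `c`; the energy does, since `c` is an
  -- affine function of `E` and `W`.
  have hc : Tendsto c atTop (𝓝 (1 - g⁻¹ * (l - r / 2 * 0))) := by
    refine ((hl.sub ((h.tendsto_planar hg hK hr).const_mul (r / 2))).const_mul g⁻¹).const_sub 1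
      |>.congr fun t => ?_
    field_simp
    ring
  have hsq := tendsto_nhds_unique (hc.pow 2) (h.tendsto_height_sq hg hK hr)
  rcases sq_eq_sq_iff_eq_or_eq_neg.1 (hsq.trans (one_pow 2).symm) with h1 | h1
  · exact Or.inl (h1 ▸ hc)
  · exact Or.inr (h1 ▸ hc)

omit hK hr hg in
include hk in
lemma tendsto_axial (h : IsReducedSolution g k K r c s W z L) {a : ℝ}
    (hc : Tendsto c atTop (𝓝 a)) : Tendsto s atTop (𝓝 (-(g * (1 - a) / k))) := by
  have hy := tendsto_zero_of_hasDerivWithinAt_linear (a := 0) (k := k)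
    (y := fun t => s t + g * (1 - a) / k) (u := fun t => g * (c t - a)) hk
    (fun t ht => by
      convert! (h.axial t ht).add_const (g * (1 - a) / k) using 1
      field_simp
      ring)
    (by simpa using (hc.sub_const a).const_mul g)
  have := hy.sub_const (g * (1 - a) / k)
  simpa using this

/-- Trajectories converging to the upper equilibrium of the pendulum carry no spin: the spin decays
like `exp (-K t)`, and the motion on the stable manifold decays strictly faster. -/
lemma spin_eq_zero (h : IsReducedSolution g k K r c s W z L) (hc : Tendsto c atTop (𝓝 (-1))) :
    L 0 = 0 := by
  by_contra hL
  obtain ⟨l, hl, hle⟩ := h.exists_energy_limit hg hK hr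
  have hl2 : l = 2 * g := by
    have := ((h.tendsto_planar hg hK hr).const_mul (r / 2)).add ((hc.const_sub 1).const_mul g)
    rw [tendsto_nhds_unique hl this]
    ring
  -- The excess energy over the upper equilibrium, nonnegative because `E` decreases to `2 g`. The
  -- weight `exp (2 K t)` cancels `W`: `(exp (2 K t) F)' = -2 K g exp (2 K t) (1 + c)`.
  set F : ℝ → ℝ := fun t => r / 2 * W t + g * (1 - c t) - 2 * g with hF
  have hF0 : ∀ t ∈ Ici (0 : ℝ), 0 ≤ F t := fun t ht => by
    have := hle t ht
    simp only [hF]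
    linarith
  have hexp : ∀ t ∈ Ici (0 : ℝ), HasDerivWithinAt (fun t => Real.exp (2 * K * t))
      (Real.exp (2 * K * t) * (2 * K)) (Ici 0) t := fun t _ => by
    simpa using ((hasDerivAt_id t).const_mul (2 * K)).exp.hasDerivWithinAt (s := Ici 0)
  have hΦ : ∀ t ∈ Ici (0 : ℝ), HasDerivWithinAt (fun t => Real.exp (2 * K * t) * F t)
      (-(2 * K * g) * (Real.exp (2 * K * t) * (1 + c t))) (Ici 0) t := fun t ht => by
    convert! (hexp t ht).mul ((h.energy_hasDerivWithinAt t ht).sub_const (2 * g)) using 1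
    ring
  have hΦanti := antitoneOn_Ici_of_hasDerivWithinAt hΦ fun t _ => by
    have : 0 ≤ 1 + c t := by linarith [h.neg_one_le_height t]
    have : 0 ≤ 2 * K * g * (Real.exp (2 * K * t) * (1 + c t)) := by positivity
    linarith
  have hLsq : ∀ t ∈ Ici (0 : ℝ), Real.exp (2 * K * t) * L t ^ 2 = L 0 ^ 2 := fun t ht => by
    have hd : ∀ t ∈ Ici (0 : ℝ),
        HasDerivWithinAt (fun t => Real.exp (2 * K * t) * L t ^ 2) 0 (Ici 0) t := fun t ht => by
      convert! (hexp t ht).mul ((h.spin t ht).pow 2) using 1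
      simp only [Pi.pow_apply]
      push_cast
      ring
    have h1 := antitoneOn_Ici_of_hasDerivWithinAt hd (fun _ _ => le_rfl) self_mem_Ici ht ht
    have h2 := antitoneOn_Ici_of_hasDerivWithinAt (fun t ht => (hd t ht).neg)
      (fun _ _ => by simp) self_mem_Ici ht ht
    simp at h1 h2
    linarith
  have hF00 : 0 ≤ F 0 := hF0 0 self_mem_Ici
  -- Chosen so that `4 (F 0 + g) η = r L(0)²`, which contradicts the bound on the spin below.
  set η := r * L 0 ^ 2 / (4 * (F 0 + g)) with hη
  have hη0 : 0 < η := by positivity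
  have hev : ∀ᶠ t in atTop, 1 + c t < η := by
    have : Tendsto (fun t => 1 + c t) atTop (𝓝 0) := by simpa using hc.const_add 1
    exact this.eventually_lt_const hη0
  obtain ⟨T, hT⟩ := eventually_atTop.1 (hev.and (eventually_ge_atTop 0))
  have hT0 : 0 ≤ T := (hT T le_rfl).2
  -- With `y = 1 + c`, the Gram relation gives `L² ≤ 2 W y`, and `r W = 2 (F + g y)`. If `exp (2 K
  -- t) y < 1`, then `r L(0)² = exp (2 K t) r L² ≤ 4 (F 0 + g) y`, impossible for `y < η`.
  have hY : ∀ t ∈ Ici T, 1 ≤ Real.exp (2 * K * t) * (1 + c t) := fun t ht => by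
    obtain ⟨hy, ht0⟩ := hT t ht
    by_contra! hlt
    have hyn : 0 ≤ 1 + c t := by linarith [h.neg_one_le_height t]
    have hLW : L t ^ 2 ≤ 2 * W t * (1 + c t) := by
      nlinarith [h.gram t, sq_nonneg (z t),
        mul_nonneg (h.planar_nonneg t) (mul_nonneg hyn hyn)]
    have h1 : L 0 ^ 2 ≤ Real.exp (2 * K * t) * (2 * W t * (1 + c t)) := by
      rw [← hLsq t ht0]; gcongr
    have h2 : Real.exp (2 * K * t) * F t ≤ F 0 := by
      simpa using hΦanti self_mem_Ici ht0 ht0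
    have h3 : r * L 0 ^ 2 ≤ 4 * ((Real.exp (2 * K * t) * F t
        + g * (Real.exp (2 * K * t) * (1 + c t))) * (1 + c t)) := by
      calc r * L 0 ^ 2 ≤ r * (Real.exp (2 * K * t) * (2 * W t * (1 + c t))) := by gcongr
        _ = _ := by simp only [hF]; ring
    have h4 : (Real.exp (2 * K * t) * F t + g * (Real.exp (2 * K * t) * (1 + c t))) * (1 + c t)
        ≤ (F 0 + g) * (1 + c t) := by
      gcongr
      nlinarith
    have h5 : (F 0 + g) * (1 + c t) < (F 0 + g) * η := by gcongr
    have h6 : 4 * ((F 0 + g) * η) = r * L 0 ^ 2 := by rw [hη]; field_simp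
    linarith
  -- Thus `exp (2 K t) F` falls at least at the constant rate `2 K g` and becomes negative, against
  -- `F ≥ 0`.
  have hlin : AntitoneOn (fun t => Real.exp (2 * K * t) * F t + 2 * K * g * t) (Ici T) :=
    antitoneOn_Ici_of_hasDerivWithinAt
      (fun t ht => (((hΦ t (hT0.trans ht)).mono (Ici_subset_Ici.2 hT0)).add
        ((hasDerivWithinAt_id t _).const_mul (2 * K * g))))
      fun t ht => by nlinarith [hY t ht, mul_pos (mul_pos two_pos hK) hg]
  set a := Real.exp (2 * K * T) * F T + 2 * K * g * T with ha
  have hT1 : T ≤ max T ((a + 1) / (2 * K * g)) := le_max_left _ _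
  have h1 := hlin self_mem_Ici hT1 hT1
  have h2 : a + 1 ≤ 2 * K * g * max T ((a + 1) / (2 * K * g)) := by
    rw [← div_le_iff₀' (by positivity)]; exact le_max_right _ _
  have h3 := mul_nonneg (Real.exp_pos (2 * K * max T ((a + 1) / (2 * K * g)))).le
    (hF0 _ (hT0.trans hT1))
  simp only at h1
  linarith

end Convergence

end IsReducedSolution

end GammaObserver

namespace GammaObserver

/-! ### Exponential decay near the desired equilibrium -/

namespace IsReducedSolution

variable {g k K r : ℝ} {c s W z L : ℝ → ℝ}

/-- Arithmetic-geometric mean inequality applied to `z² ≤ 2 (1 - c) W`, weighted so that only half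
of the dissipation in `1 - c` is spent. -/
lemma abs_friction_mul_climb_le (h : IsReducedSolution g k K r c s W z L) (hg : 0 < g) (t : ℝ) :
    |K * z t| ≤ g * (1 - c t) / 2 + K ^ 2 / g * W t := by
  have hW := h.planar_nonneg t
  have hV : 0 ≤ 1 - c t := sub_nonneg.2 (h.height_le t)
  have hzW : z t ^ 2 ≤ 2 * (1 - c t) * W t := by
    nlinarith [h.climb_sq_le t, mul_nonneg hW (sq_nonneg (1 - c t))]
  refine abs_le_of_sq_le_sq ?_ (by positivity)
  have h1 : (g * (1 - c t) / 2 + K ^ 2 / g * W t) ^ 2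
      = (g * (1 - c t) / 2 - K ^ 2 / g * W t) ^ 2 + K ^ 2 * (2 * (1 - c t) * W t) := by
    field_simp
    ring
  rw [h1, mul_pow]
  have := mul_le_mul_of_nonneg_left hzW (sq_nonneg K)
  have := sq_nonneg (g * (1 - c t) / 2 - K ^ 2 / g * W t)
  linarith

/-- Makes the corrected energy comparable with the energy: `ε z` is at most half of it. -/
lemma abs_small_mul_climb_le (h : IsReducedSolution g k K r c s W z L) (hg : 0 < g) (hK : 0 < K)
    {ε : ℝ} (hε : 0 < ε) (hε1 : ε ≤ K) (hε2 : ε * (4 * K) ≤ r * g) (t : ℝ) :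
    |ε * z t| ≤ g * (1 - c t) / 2 + r / 4 * W t := by
  have hV : 0 ≤ 1 - c t := sub_nonneg.2 (h.height_le t)
  have h1 : |ε * z t| = ε / K * |K * z t| := by
    rw [abs_mul, abs_mul, abs_of_pos hε, abs_of_pos hK]
    field_simp
  have h2 : ε / K ≤ 1 := (div_le_one hK).2 hε1
  have h3 : ε / K * (K ^ 2 / g) ≤ r / 4 := by
    rw [div_mul_div_comm, div_le_div_iff₀ (by positivity) (by norm_num)]
    nlinarith
  have hgV : 0 ≤ g * (1 - c t) / 2 := by positivity
  calc |ε * z t| ≤ ε / K * (g * (1 - c t) / 2 + K ^ 2 / g * W t) := by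
        rw [h1]; exact mul_le_mul_of_nonneg_left (h.abs_friction_mul_climb_le hg t) (by positivity)
    _ = ε / K * (g * (1 - c t) / 2) + ε / K * (K ^ 2 / g) * W t := by ring
    _ ≤ 1 * (g * (1 - c t) / 2) + r / 4 * W t :=
        add_le_add (mul_le_mul_of_nonneg_right h2 hgV)
          (mul_le_mul_of_nonneg_right h3 (h.planar_nonneg t))
    _ = _ := by rw [one_mul]

lemma height_nonneg (h : IsReducedSolution g k K r c s W z L) (hg : 0 < g) (hK : 0 < K)
    (hr : 0 < r) (hE : r / 2 * W 0 + g * (1 - c 0) < g) {t : ℝ} (ht : t ∈ Ici (0 : ℝ)) :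
    0 ≤ c t := by
  have h1 := h.energy_antitoneOn hK hr self_mem_Ici ht ht
  simp only at h1
  have h2 := mul_nonneg (half_pos hr).le (h.planar_nonneg t)
  by_contra! hlt
  have := mul_pos_of_neg_of_neg (neg_lt_zero.2 hg) hlt
  linarith

/-- The correction `-ε z` contributes `-ε g (1 - c²)`, the dissipation of the height that `E'`
lacks. -/
lemma lyapunov_hasDerivWithinAt (h : IsReducedSolution g k K r c s W z L) (ε η : ℝ) :
    ∀ t ∈ Ici (0 : ℝ), HasDerivWithinAt
      (fun t => r / 2 * W t + g * (1 - c t) - ε * z t + η * s t ^ 2)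
      (-(r * K) * W t + ε * (r * W t * c t) - ε * (g * (1 - c t ^ 2)) + ε * (K * z t)
        + (-(2 * η * k) * s t ^ 2 - 2 * η * g * (s t * (1 - c t)))) (Ici 0) t := fun t ht => by
  convert! ((h.energy_hasDerivWithinAt t ht).sub ((h.climb t ht).const_mul ε)).add
    (((h.axial t ht).pow 2).const_mul η) using 1
  push_cast
  ring

/-- The energy, corrected by a small multiple of the climb rate and of the squared axial velocity,
decays exponentially in the sublevel set of the energy where the height stays positive. -/
lemma lyapunov_le (h : IsReducedSolution g k K r c s W z L) (hg : 0 < g) (hk : 0 < k) (hK : 0 < K)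
    (hr : 0 < r) {ε η ρ : ℝ} (hε : 0 < ε) (hε1 : ε ≤ K) (hε2 : ε * (4 * K) ≤ r * g)
    (hε3 : ε * (r + K ^ 2 / g) ≤ r * K / 2) (hη : η = ε * k / (4 * g)) (hρ0 : 0 < ρ)
    (hρ1 : ρ ≤ 2 * K / 3) (hρ2 : ρ ≤ ε / 6) (hρ3 : ρ ≤ k)
    (hE : r / 2 * W 0 + g * (1 - c 0) < g) {t : ℝ} (ht : t ∈ Ici (0 : ℝ)) :
    r / 2 * W t + g * (1 - c t) - ε * z t + η * s t ^ 2 ≤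
      (r / 2 * W 0 + g * (1 - c 0) - ε * z 0 + η * s 0 ^ 2) * Real.exp (-ρ * t) := by
  have hη0 : 0 < η := by rw [hη]; positivity
  have key := le_mul_exp_of_hasDerivWithinAt_le (c := ρ) (h.lyapunov_hasDerivWithinAt ε η)
    (fun t ht => ?_) ht
  · rwa [sub_zero] at key
  have hW := h.planar_nonneg t
  have hV : 0 ≤ 1 - c t := sub_nonneg.2 (h.height_le t)
  have hc := h.height_nonneg hg hK hr hE ht
  have a1 : ε * (r * W t * c t) ≤ ε * r * W t := by
    have : 0 ≤ ε * r * W t * (1 - c t) := by positivity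
    linarith
  have a2 : ε * g * (1 - c t) ≤ ε * (g * (1 - c t ^ 2)) := by
    have : 0 ≤ ε * g * (c t * (1 - c t)) := by positivity
    linarith
  have a3 : ε * (K * z t) ≤ ε * (g * (1 - c t) / 2 + K ^ 2 / g * W t) :=
    mul_le_mul_of_nonneg_left ((le_abs_self _).trans (h.abs_friction_mul_climb_le hg t)) hε.le
  have a4 : ε * (r + K ^ 2 / g) * W t ≤ r * K / 2 * W t := mul_le_mul_of_nonneg_right hε3 hW
  -- The value `η = ε k / (4 g)` is what lets half of the damping of `s` and a quarter of `ε g (1 -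
  -- c)` absorb the coupling; `(1 - c)² ≤ 1 - c` uses `0 ≤ c`.
  have a5 : -(2 * η * g * (s t * (1 - c t))) ≤ η * k * s t ^ 2 + ε * g / 4 * (1 - c t) := by
    have e1 : ε * g / 4 = η * (g ^ 2 / k) := by rw [hη]; field_simp
    have e2 : η * k * s t ^ 2 + η * (g ^ 2 / k) * (1 - c t) ^ 2
        + 2 * η * g * (s t * (1 - c t)) = η / k * (k * s t + g * (1 - c t)) ^ 2 := by
      field_simp
      ring
    have e3 : (1 - c t) ^ 2 ≤ 1 - c t := by nlinarith
    have e4 : 0 ≤ η / k * (k * s t + g * (1 - c t)) ^ 2 := by positivity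
    have e5 := mul_le_mul_of_nonneg_left e3 (by positivity : 0 ≤ η * (g ^ 2 / k))
    rw [e1]
    linarith
  have a6 : r / 2 * W t + g * (1 - c t) - ε * z t + η * s t ^ 2
      ≤ 3 * r / 4 * W t + 3 * g / 2 * (1 - c t) + η * s t ^ 2 := by
    have := (neg_le_abs (ε * z t)).trans (h.abs_small_mul_climb_le hg hK hε hε1 hε2 t)
    linarith
  -- What remains of the dissipation is `r K / 2 * W + ε g / 4 * (1 - c) + η k s²`; the three bounds
  -- on `ρ` compare it term by term with `ρ` times the right side of `a6`.
  have a7 := mul_le_mul_of_nonneg_left a6 hρ0.le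
  have a8 := mul_le_mul_of_nonneg_right hρ1 (by positivity : 0 ≤ 3 * r / 4 * W t)
  have a9 := mul_le_mul_of_nonneg_right hρ2 (by positivity : 0 ≤ 3 * g / 2 * (1 - c t))
  have a10 := mul_le_mul_of_nonneg_right hρ3 (by positivity : 0 ≤ η * s t ^ 2)
  linarith

end IsReducedSolution

/-- For the error system the decaying quantity is `|v|² + |γ - e3|²`. The constants are uniform over
solutions. -/
lemma exists_exponential_decay {g k K r : ℝ} (hg : 0 < g) (hk : 0 < k) (hK : 0 < K) (hr : 0 < r) :
    ∃ C > 0, ∃ ρ > 0, ∀ c s W z L : ℝ → ℝ, IsReducedSolution g k K r c s W z L →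
      r / 2 * W 0 + g * (1 - c 0) < g → ∀ t ∈ Ici (0 : ℝ),
        W t + s t ^ 2 + 2 * (1 - c t) ≤
          C * Real.exp (-ρ * t) * (W 0 + s 0 ^ 2 + 2 * (1 - c 0)) := by
  obtain ⟨ε, hε, hε1, hε2, hε3⟩ : ∃ ε > 0, ε ≤ K ∧ ε * (4 * K) ≤ r * g ∧
      ε * (r + K ^ 2 / g) ≤ r * K / 2 := by
    refine ⟨min K (min (r * g / (4 * K)) (r * K / 2 / (r + K ^ 2 / g))), by positivity,
      min_le_left _ _, ?_, ?_⟩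
    · rw [← le_div_iff₀ (by positivity)]
      exact (min_le_right _ _).trans (min_le_left _ _)
    · rw [← le_div_iff₀ (by positivity)]
      exact (min_le_right _ _).trans (min_le_right _ _)
  obtain ⟨η, hη⟩ : ∃ η, η = ε * k / (4 * g) := ⟨_, rfl⟩
  have hη0 : 0 < η := by rw [hη]; positivity
  obtain ⟨ρ, hρ0, hρ1, hρ2, hρ3⟩ : ∃ ρ > 0, ρ ≤ 2 * K / 3 ∧ ρ ≤ ε / 6 ∧ ρ ≤ k :=
    ⟨min (2 * K / 3) (min (ε / 6) k), by positivity, min_le_left _ _,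
      (min_le_right _ _).trans (min_le_left _ _), (min_le_right _ _).trans (min_le_right _ _)⟩
  obtain ⟨m, hm0, hm1, hm2, hm3⟩ : ∃ m > 0, m ≤ r / 4 ∧ m ≤ g / 4 ∧ m ≤ η :=
    ⟨min (r / 4) (min (g / 4) η), by positivity, min_le_left _ _,
      (min_le_right _ _).trans (min_le_left _ _), (min_le_right _ _).trans (min_le_right _ _)⟩
  obtain ⟨M, hM0, hM1, hM2, hM3⟩ : ∃ M > 0, 3 * r / 4 ≤ M ∧ 3 * g / 4 ≤ M ∧ η ≤ M :=
    ⟨3 * r / 4 + 3 * g / 4 + η, by positivity, by linarith, by linarith, by linarith⟩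
  refine ⟨M / m, by positivity, ρ, hρ0, fun c s W z L h hE t ht => ?_⟩
  have hdecay := h.lyapunov_le hg hk hK hr hε hε1 hε2 hε3 hη hρ0 hρ1 hρ2 hρ3 hE ht
  have hV : ∀ t, 0 ≤ 1 - c t := fun t => sub_nonneg.2 (h.height_le t)
  have hεz := h.abs_small_mul_climb_le hg hK hε hε1 hε2
  have hlow : m * (W t + s t ^ 2 + 2 * (1 - c t)) ≤
      r / 2 * W t + g * (1 - c t) - ε * z t + η * s t ^ 2 := by
    have := (le_abs_self (ε * z t)).trans (hεz t)
    have b1 := mul_le_mul_of_nonneg_right hm1 (h.planar_nonneg t)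
    have b2 := mul_le_mul_of_nonneg_right hm2 (hV t)
    have b3 := mul_le_mul_of_nonneg_right hm3 (sq_nonneg (s t))
    linarith
  have hup : r / 2 * W 0 + g * (1 - c 0) - ε * z 0 + η * s 0 ^ 2 ≤
      M * (W 0 + s 0 ^ 2 + 2 * (1 - c 0)) := by
    have := (neg_le_abs (ε * z 0)).trans (hεz 0)
    have b1 := mul_le_mul_of_nonneg_right hM1 (h.planar_nonneg 0)
    have b2 := mul_le_mul_of_nonneg_right hM2 (hV 0)
    have b3 := mul_le_mul_of_nonneg_right hM3 (sq_nonneg (s 0))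
    linarith
  have := mul_le_mul_of_nonneg_right hup (Real.exp_pos (-ρ * t)).le
  rw [div_mul_eq_mul_div, div_mul_eq_mul_div, le_div_iff₀ hm0]
  linarith

end GammaObserver

namespace GammaObserver

/-! ### The error system in coordinates -/

lemma cross_zero (u v : E3) : cross u v 0 = u 1 * v 2 - u 2 * v 1 := by
  simp [cross, cross_apply]

lemma cross_one (u v : E3) : cross u v 1 = u 2 * v 0 - u 0 * v 2 := by
  simp [cross, cross_apply]

lemma cross_two (u v : E3) : cross u v 2 = u 0 * v 1 - u 1 * v 0 := by
  simp [cross, cross_apply]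

/-- The scalar product, in coordinates. -/
def dot (u v : E3) : ℝ := u 0 * v 0 + u 1 * v 1 + u 2 * v 2

lemma norm_sq_eq_dot (u : E3) : ‖u‖ ^ 2 = dot u u := by
  rw [EuclideanSpace.real_norm_sq_eq, Fin.sum_univ_three, dot]
  ring

lemma cross_cross_apply (u v : E3) (i : Fin 3) :
    cross u (cross u v) i = dot u v * u i - dot u u * v i := by
  fin_cases i <;> simp [cross_zero, cross_one, cross_two, dot] <;> ring

lemma dot_comm (u v : E3) : dot u v = dot v u := by
  simp only [dot]; ring

lemma dot_self_sphere (γ : S2) : dot (γ : E3) γ = 1 := by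
  rw [← norm_sq_eq_dot, norm_eq_of_mem_sphere, one_pow]

lemma e3_zero : e3 0 = 0 := by simp [e3]
lemma e3_one : e3 1 = 0 := by simp [e3]
lemma e3_two : e3 2 = 1 := by simp [e3]

lemma directionField_apply (k1r : ℝ) (v γ : E3) (i : Fin 3) :
    directionField k1r v γ i = k1r * (dot γ γ * v i - dot γ v * γ i) := by
  simp only [directionField, PiLp.neg_apply, PiLp.smul_apply, smul_eq_mul, cross_cross_apply]
  ring

lemma velocityField_apply (g k1v k2v k1r : ℝ) (v γ : E3) (i : Fin 3) :
    velocityField g k1v k2v k1r v γ i = g * (e3 i - γ i) - k1v * v i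
      + k2v * (dot γ v * γ i - dot γ γ * v i) + k1r * (dot γ v * v i - dot v v * γ i) := by
  simp only [velocityField, PiLp.add_apply, PiLp.sub_apply, PiLp.smul_apply, smul_eq_mul,
    cross_cross_apply, dot_comm v γ]

/-- The third coordinate of the direction error. -/
def height (p : ErrorState) : ℝ := (p.2 : E3) 2

/-- The velocity error along the direction error. -/
def axialVelocity (p : ErrorState) : ℝ := dot (p.2 : E3) p.1

/-- The squared norm of the velocity error orthogonal to the direction error. -/
def planarVelocitySq (p : ErrorState) : ℝ := dot p.1 p.1 - axialVelocity p ^ 2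

/-- The third coordinate of the velocity error orthogonal to the direction error. -/
def climbRate (p : ErrorState) : ℝ := p.1 2 - axialVelocity p * height p

/-- The third coordinate of the cross product of the direction and velocity errors. -/
def spin (p : ErrorState) : ℝ := (p.2 : E3) 0 * p.1 1 - (p.2 : E3) 1 * p.1 0

lemma hasDerivWithinAt_apply {f : ℝ → E3} {f' : E3} {s : Set ℝ} {t : ℝ}
    (h : HasDerivWithinAt f f' s t) (i : Fin 3) :
    HasDerivWithinAt (fun t => f t i) (f' i) s t :=
  ((EuclideanSpace.proj (𝕜 := ℝ) i).hasFDerivAt.comp_hasDerivWithinAt t h)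

lemma hasDerivWithinAt_dot {f h : ℝ → E3} {f' h' : E3} {s : Set ℝ} {t : ℝ}
    (hf : HasDerivWithinAt f f' s t) (hh : HasDerivWithinAt h h' s t) :
    HasDerivWithinAt (fun t => dot (f t) (h t)) (dot f' (h t) + dot (f t) h') s t := by
  have hi := fun i => (hasDerivWithinAt_apply hf i).mul (hasDerivWithinAt_apply hh i)
  convert! ((hi 0).add (hi 1)).add (hi 2) using 1
  simp only [dot]
  ring

/-- The `k1r` terms cancel both in `(γ·v)'` and in `(|v|²)'`, so `s` is driven by `c` alone.
Everything else is algebra modulo `|γ| = 1`. -/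
lemma isReducedSolution {g k1v k2v k1r : ℝ} {ξ : ℝ → ErrorState}
    (hξ : ξ ∈ trajectories g k1v k2v k1r) :
    IsReducedSolution g k1v (k1v + k2v) k1r (fun t => height (ξ t)) (fun t => axialVelocity (ξ t))
      (fun t => planarVelocitySq (ξ t)) (fun t => climbRate (ξ t)) (fun t => spin (ξ t)) := by
  have hN := fun t => dot_self_sphere (ξ t).2
  have hc : ∀ t ∈ Ici (0 : ℝ), HasDerivWithinAt (fun t => height (ξ t)) (k1r * climbRate (ξ t))
      (Ici 0) t := fun t ht => by
    convert! hasDerivWithinAt_apply (hξ t ht).2 2 using 1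
    rw [directionField_apply, hN t, climbRate, axialVelocity, height]
    ring
  have hs : ∀ t ∈ Ici (0 : ℝ), HasDerivWithinAt (fun t => axialVelocity (ξ t))
      (-k1v * axialVelocity (ξ t) + -(g * (1 - height (ξ t)))) (Ici 0) t := fun t ht => by
    convert! hasDerivWithinAt_dot (hξ t ht).2 (hξ t ht).1 using 1
    have h1 := hN t
    simp only [dot, directionField_apply, velocityField_apply, e3_zero, e3_one, e3_two,
      axialVelocity, height] at h1 ⊢
    generalize ((ξ t).2 : E3) 0 = a at *
    generalize ((ξ t).2 : E3) 1 = b at *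
    generalize ((ξ t).2 : E3) 2 = c at *
    generalize (ξ t).1 0 = x at *
    generalize (ξ t).1 1 = y at *
    generalize (ξ t).1 2 = z at *
    linear_combination g * h1
  have hv2 : ∀ t ∈ Ici (0 : ℝ), HasDerivWithinAt (fun t => dot (ξ t).1 (ξ t).1)
      (2 * (g * ((ξ t).1 2 - axialVelocity (ξ t)) - k1v * dot (ξ t).1 (ξ t).1
        - k2v * planarVelocitySq (ξ t))) (Ici 0) t := fun t ht => by
    convert! hasDerivWithinAt_dot (hξ t ht).1 (hξ t ht).1 using 1
    have h1 := hN t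
    simp only [dot, velocityField_apply, e3_zero, e3_one, e3_two,
      axialVelocity, planarVelocitySq] at h1 ⊢
    rw [h1]
    ring
  refine ⟨hc, hs, fun t ht => ?_, fun t ht => ?_, fun t ht => ?_, fun t => ?_, fun t => ?_,
    fun t => ?_⟩
  · convert! (hv2 t ht).sub ((hs t ht).pow 2) using 1
    simp only [planarVelocitySq, climbRate]
    push_cast
    ring
  · convert! (hasDerivWithinAt_apply (hξ t ht).1 2).sub ((hs t ht).mul (hc t ht)) using 1
    rw [velocityField_apply, hN t, e3_two]
    simp only [planarVelocitySq, climbRate, axialVelocity, height]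
    ring
  · have hγ := fun i => hasDerivWithinAt_apply (hξ t ht).2 i
    have hv := fun i => hasDerivWithinAt_apply (hξ t ht).1 i
    convert! ((hγ 0).mul (hv 1)).sub ((hγ 1).mul (hv 0)) using 1
    simp only [directionField_apply, velocityField_apply, hN t, e3_zero, e3_one, spin]
    ring
  · have h1 := hN t
    -- Lagrange's identity `|v|² - (γ·v)² = |γ × v|²`.
    have h2 : planarVelocitySq (ξ t) = spin (ξ t) ^ 2
        + ((ξ t).2.1 1 * (ξ t).1 2 - (ξ t).2.1 2 * (ξ t).1 1) ^ 2
        + ((ξ t).2.1 2 * (ξ t).1 0 - (ξ t).2.1 0 * (ξ t).1 2) ^ 2 := by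
      simp only [dot, planarVelocitySq, axialVelocity, spin] at h1 ⊢
      linear_combination (-((ξ t).1 0 * (ξ t).1 0 + (ξ t).1 1 * (ξ t).1 1
        + (ξ t).1 2 * (ξ t).1 2)) * h1
    simp only [h2]
    positivity
  · have h1 := hN t
    simp only [dot, height] at h1 ⊢
    nlinarith [mul_self_nonneg (((ξ t).2 : E3) 0), mul_self_nonneg (((ξ t).2 : E3) 1)]
  · have h1 := hN t
    -- Lagrange's identity in the plane orthogonal to `γ`, for the projections of `v` and `e3`;
    -- homogenised by `N = |γ|²` so that `ring` proves it.
    have key : ∀ a b c x y z N : ℝ, a * a + b * b + c * c = N →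
        (N * z - (a * x + b * y + c * z) * c) ^ 2 + N * (a * y - b * x) ^ 2 =
          (N * (x * x + y * y + z * z) - (a * x + b * y + c * z) ^ 2) * (N - c ^ 2) := by
      rintro a b c x y z N rfl
      ring
    have h2 := key _ _ _ ((ξ t).1 0) ((ξ t).1 1) ((ξ t).1 2) _ h1
    simp only [planarVelocitySq, climbRate, axialVelocity, height, spin, dot]
    linarith

/-! ### Distances to the equilibria -/

lemma dist_sq_eq (u v : E3) : dist u v ^ 2 = dot u u - 2 * dot u v + dot v v := by
  rw [dist_eq_norm, norm_sq_eq_dot]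
  simp only [dot, PiLp.sub_apply]
  ring

lemma dist_direction_desired_sq (p : ErrorState) : dist p.2 e3S ^ 2 = 2 * (1 - height p) := by
  rw [Subtype.dist_eq, dist_sq_eq, dot_self_sphere, dot_self_sphere]
  simp only [dot, e3S, e3_zero, e3_one, e3_two, height]
  ring

lemma dist_direction_undesired_sq (p : ErrorState) :
    dist p.2 (-e3S) ^ 2 = 2 * (1 + height p) := by
  rw [Subtype.dist_eq, dist_sq_eq, dot_self_sphere, dot_self_sphere]
  simp only [dot, e3S, coe_neg_sphere, PiLp.neg_apply, e3_zero, e3_one, e3_two, height]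
  ring

lemma dist_velocity_sq (p : ErrorState) (a : ℝ) : dist p.1 (a • e3) ^ 2 =
    planarVelocitySq p + axialVelocity p ^ 2
      - 2 * a * (climbRate p + axialVelocity p * height p) + a ^ 2 := by
  rw [dist_sq_eq]
  simp only [dot, PiLp.smul_apply, smul_eq_mul, e3_zero, e3_one, e3_two, height, climbRate,
    planarVelocitySq]
  ring

/-- The product carries the sup distance, whose square lies between half of the Euclidean sum and
the sum itself. -/
lemma dist_desired_sq_le (p : ErrorState) (hW : 0 ≤ planarVelocitySq p) : dist p desired ^ 2 ≤
    planarVelocitySq p + axialVelocity p ^ 2 + 2 * (1 - height p) := by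
  have h1 := dist_direction_desired_sq p
  have h2 := dist_velocity_sq p 0
  rw [zero_smul] at h2
  rw [Prod.dist_eq, desired]
  rcases max_choice (dist p.1 (0 : E3)) (dist p.2 e3S) with h | h <;> rw [h]
  · have := sq_nonneg (dist p.2 e3S)
    linarith
  · have := sq_nonneg (axialVelocity p)
    linarith

lemma le_dist_desired_sq (p : ErrorState) :
    planarVelocitySq p + axialVelocity p ^ 2 + 2 * (1 - height p) ≤ 2 * dist p desired ^ 2 := by
  have h1 := dist_direction_desired_sq p
  have h2 := dist_velocity_sq p 0
  rw [zero_smul] at h2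
  have h3 : dist p.1 (0 : E3) ≤ dist p desired := le_max_left _ _
  have h4 : dist p.2 e3S ≤ dist p desired := le_max_right _ _
  have h5 := pow_le_pow_left₀ dist_nonneg h3 2
  have h6 := pow_le_pow_left₀ dist_nonneg h4 2
  linarith

/-! ### Equilibria -/

/-- Vanishing of the direction field means `v = s γ`; the velocity equation then reads `g e3 = (g +
k1v s) γ`, so `γ = ±e3` and `s` is determined. -/
lemma equilibria_eq {g k1v k2v k1r : ℝ} (hg : 0 < g) (hk1v : 0 < k1v) (hk1r : 0 < k1r) :
    equilibria g k1v k2v k1r = {desired, undesired g k1v} := by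
  ext ⟨v, γ⟩
  simp only [equilibria, mem_ofPred_eq, mem_insert_iff, mem_singleton_iff, desired, undesired,
    Prod.mk.injEq]
  have hN := dot_self_sphere γ
  constructor
  · rintro ⟨h1, h2⟩
    have hv : ∀ i, v i = dot (γ : E3) v * (γ : E3) i := fun i => by
      have := congrArg (fun u : E3 => u i) h2
      simp only [directionField_apply, hN, PiLp.zero_apply, mul_eq_zero, hk1r.ne', false_or,
        one_mul] at this
      linarith
    have hf : ∀ i, g * e3 i = (g + k1v * dot (γ : E3) v) * (γ : E3) i := fun i => by
      have := congrArg (fun u : E3 => u i) h1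
      simp only [velocityField_apply, hN, PiLp.zero_apply] at this
      have hvv : dot v v = dot (γ : E3) v ^ 2 := by
        have h0 := hv 0
        have h1 := hv 1
        have h2 := hv 2
        generalize hs : dot (γ : E3) v = s at *
        simp only [dot] at hs ⊢
        linear_combination v 0 * h0 + v 1 * h1 + v 2 * h2 + s * hs
      rw [hvv] at this
      linear_combination this + (k1v + k2v - k1r * dot (γ : E3) v) * hv i
    have h0 := hf 0
    have h1 := hf 1
    have h2 := hf 2
    rw [e3_zero, mul_zero, eq_comm, mul_eq_zero] at h0
    rw [e3_one, mul_zero, eq_comm, mul_eq_zero] at h1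
    rw [e3_two, mul_one] at h2
    have hne : g + k1v * dot (γ : E3) v ≠ 0 := fun h => by
      rw [h, zero_mul] at h2
      exact hg.ne' h2
    have h0 := h0.resolve_left hne
    have h1 := h1.resolve_left hne
    have hc : (γ : E3) 2 ^ 2 = 1 ^ 2 := by
      simp only [dot, h0, h1] at hN
      linarith
    rcases sq_eq_sq_iff_eq_or_eq_neg.1 hc with hc | hc
    · left
      rw [hc] at h2
      have hs : dot (γ : E3) v = 0 := by
        have : k1v * dot (γ : E3) v = 0 := by linarith
        exact (mul_eq_zero.1 this).resolve_left hk1v.ne'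
      constructor
      · ext i
        rw [hv i, hs, zero_mul, PiLp.zero_apply]
      · ext i
        fin_cases i <;> simp [e3S, e3_zero, e3_one, e3_two, h0, h1, hc]
    · right
      rw [hc] at h2
      have hs : dot (γ : E3) v = -(2 * g / k1v) := by
        field_simp
        linarith
      constructor
      · ext i
        rw [hv i, hs]
        fin_cases i <;> simp [e3_zero, e3_one, e3_two, h0, h1, hc]
      · ext i
        fin_cases i <;> simp [e3S, e3_zero, e3_one, e3_two, h0, h1, hc]
  · rintro (⟨rfl, rfl⟩ | ⟨rfl, rfl⟩)
    · constructor <;> ext i <;> fin_cases i <;>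
        simp [velocityField_apply, directionField_apply, dot, e3S, e3_zero, e3_one, e3_two]
    · constructor <;> ext i <;> fin_cases i <;>
        simp [velocityField_apply, directionField_apply, dot, e3S, e3_zero, e3_one, e3_two]
      field_simp
      ring

lemma desired_ne_undesired (g k1v : ℝ) : desired ≠ undesired g k1v := fun h => by
  have h1 := congrArg height h
  simp [height, desired, undesired, e3S, e3_two] at h1
  linarith

end GammaObserver

/-! ### Global solutions of ordinary differential equations -/

section ODE

variable {E : Type*} [NormedAddCommGroup E] [NormedSpace ℝ E]

lemma HasDerivWithinAt.Ici_of_Icc {f : ℝ → E} {f' : E} {a b t : ℝ} (ht : t ∈ Ico a b)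
    (h : HasDerivWithinAt f f' (Icc a b) t) : HasDerivWithinAt f f' (Ici t) t :=
  h.mono_of_mem_nhdsWithin (mem_of_superset (Icc_mem_nhdsGE ht.2) (Icc_subset_Icc_left ht.1))

/-- Both curves stay in one closed ball, on which `F` is Lipschitz. -/
lemma eqOn_Icc_of_contDiff [FiniteDimensional ℝ E] {F : E → E} (hF : ContDiff ℝ 1 F)
    {T : ℝ} {α β : ℝ → E}
    (hα : ∀ t ∈ Icc 0 T, HasDerivWithinAt α (F (α t)) (Icc 0 T) t)
    (hβ : ∀ t ∈ Icc 0 T, HasDerivWithinAt β (F (β t)) (Icc 0 T) t) (h0 : α 0 = β 0) :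
    EqOn α β (Icc 0 T) := by
  have hαc : ContinuousOn α (Icc 0 T) := fun t ht => (hα t ht).continuousWithinAt
  have hβc : ContinuousOn β (Icc 0 T) := fun t ht => (hβ t ht).continuousWithinAt
  obtain ⟨R, hR⟩ := ((isCompact_Icc.image_of_continuousOn hαc).union
    (isCompact_Icc.image_of_continuousOn hβc)).isBounded.subset_closedBall 0
  obtain ⟨K, hK⟩ := hF.contDiffOn.exists_lipschitzOnWith one_ne_zero
    (convex_closedBall (0 : E) R) (isCompact_closedBall 0 R)
  have hsub : Ico 0 T ⊆ Icc 0 T := Ico_subset_Icc_self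
  exact ODE_solution_unique_of_mem_Icc_right (v := fun _ => F) (s := fun _ => Metric.closedBall 0 R)
    (fun _ _ => hK) hαc (fun t ht => (hα t (hsub ht)).Ici_of_Icc ht)
    (fun t ht => hR (Or.inl (mem_image_of_mem α (hsub ht)))) hβc
    (fun t ht => (hβ t (hsub ht)).Ici_of_Icc ht)
    (fun t ht => hR (Or.inr (mem_image_of_mem β (hsub ht)))) h0

/-- A compactly supported vector field has global solutions in forward time. -/
lemma exists_solution_Ici_of_hasCompactSupport [FiniteDimensional ℝ E] {F : E → E}
    (hF : ContDiff ℝ 1 F) (hc : HasCompactSupport F) (x : E) :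
    ∃ α : ℝ → E, α 0 = x ∧ ∀ t ∈ Ici (0 : ℝ), HasDerivWithinAt α (F (α t)) (Ici 0) t := by
  obtain ⟨K, hK⟩ := hF.lipschitzWith_of_hasCompactSupport hc one_ne_zero
  obtain ⟨C, hC⟩ := hc.exists_bound_of_continuous hF.continuous
  lift C to NNReal using (norm_nonneg _).trans (hC x)
  have hloc : ∀ n : ℕ, ∃ α : ℝ → E, α 0 = x ∧
      ∀ t ∈ Icc (0 : ℝ) n, HasDerivWithinAt α (F (α t)) (Icc 0 n) t := fun n => by
    have h0 : (0 : ℝ) ∈ Icc (0 : ℝ) n := ⟨le_rfl, n.cast_nonneg⟩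
    -- The bound `C` on `F` is global, so a ball of radius `C n` imposes no restriction on the time
    -- `n`.
    have hPL : IsPicardLindelof (fun _ => F) (⟨0, h0⟩ : Icc (0 : ℝ) n) x
        (C * n) 0 C K :=
      IsPicardLindelof.of_time_independent (fun y _ => hC y) hK.lipschitzOnWith (by simp)
    exact hPL.exists_eq_forall_mem_Icc_hasDerivWithinAt₀
  choose α hα0 hα using hloc
  have heq : ∀ m n : ℕ, m ≤ n → EqOn (α m) (α n) (Icc 0 m) := fun m n hmn =>
    eqOn_Icc_of_contDiff hF (hα m)
      (fun t ht => (hα n t ⟨ht.1, ht.2.trans (Nat.cast_le.2 hmn)⟩).mono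
        (Icc_subset_Icc_right (Nat.cast_le.2 hmn))) ((hα0 m).trans (hα0 n).symm)
  -- The solutions on `[0, n]` are glued; by uniqueness they agree on overlaps.
  refine ⟨fun t => α ⌈t⌉₊ t, by simp [hα0], fun t ht => ?_⟩
  obtain ⟨n, hn⟩ := exists_nat_gt t
  have hβ : ∀ s ∈ Icc (0 : ℝ) n, α ⌈s⌉₊ s = α n s := fun s hs =>
    heq _ _ (Nat.ceil_le.2 hs.2) ⟨hs.1, Nat.le_ceil s⟩
  have htn : t ∈ Icc (0 : ℝ) n := ⟨ht, hn.le⟩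
  have hnhds : Icc (0 : ℝ) n ∈ 𝓝[Ici 0] t := by
    rw [← Ici_inter_Iic]
    exact inter_mem self_mem_nhdsWithin (mem_nhdsWithin_of_mem_nhds (Iic_mem_nhds hn))
  have := (hα n t htn).congr_of_mem hβ htn
  rw [← hβ t htn] at this
  exact this.mono_of_mem_nhdsWithin hnhds

end ODE

namespace GammaObserver

/-! ### Existence and uniqueness of the error trajectories -/

/-- The right-hand side of the error system, as a vector field on `ℝ³ × ℝ³`. -/
noncomputable def errorField (g k1v k2v k1r : ℝ) (x : E3 × E3) : E3 × E3 :=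
  (velocityField g k1v k2v k1r x.1 x.2, directionField k1r x.1 x.2)

lemma contDiff_errorField (g k1v k2v k1r : ℝ) : ContDiff ℝ 1 (errorField g k1v k2v k1r) := by
  have h1 : ∀ i : Fin 3, ContDiff ℝ 1 fun x : E3 × E3 => x.1 i := fun i =>
    (EuclideanSpace.proj (𝕜 := ℝ) i).contDiff.comp contDiff_fst
  have h2 : ∀ i : Fin 3, ContDiff ℝ 1 fun x : E3 × E3 => x.2 i := fun i =>
    (EuclideanSpace.proj (𝕜 := ℝ) i).contDiff.comp contDiff_snd
  refine ContDiff.prodMk (contDiff_euclidean.2 fun i => ?_) (contDiff_euclidean.2 fun i => ?_)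
  · simp only [velocityField_apply, dot]
    fun_prop
  · simp only [directionField_apply, dot]
    fun_prop

/-- A priori bounds for the error system, up to a nonnegative change of time scale `χ`. -/
lemma velocity_sq_le_of_solution {g k1v k2v k1r M : ℝ} (hg : 0 < g) (hk1v : 0 < k1v)
    (hk2v : 0 < k2v) (hM : 4 * g ^ 2 / k1v ^ 2 < M) {χ : E3 × E3 → ℝ}
    (hχ : ∀ x, dot x.1 x.1 = M → dot x.2 x.2 = 1 → 0 < χ x) {α : ℝ → E3 × E3}
    (hα : ∀ t ∈ Ici (0 : ℝ),
      HasDerivWithinAt α (χ (α t) • errorField g k1v k2v k1r (α t)) (Ici 0) t)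
    (h1 : dot (α 0).1 (α 0).1 ≤ M) (h2 : dot (α 0).2 (α 0).2 = 1) :
    ∀ t ∈ Ici (0 : ℝ), dot (α t).1 (α t).1 ≤ M ∧ dot (α t).2 (α t).2 = 1 := by
  have hv : ∀ t ∈ Ici (0 : ℝ), HasDerivWithinAt (fun t => (α t).1)
      (χ (α t) • velocityField g k1v k2v k1r (α t).1 (α t).2) (Ici 0) t := fun t ht =>
    (ContinuousLinearMap.fst ℝ E3 E3).hasFDerivAt.comp_hasDerivWithinAt t (hα t ht)
  have hγ : ∀ t ∈ Ici (0 : ℝ), HasDerivWithinAt (fun t => (α t).2)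
      (χ (α t) • directionField k1r (α t).1 (α t).2) (Ici 0) t := fun t ht =>
    (ContinuousLinearMap.snd ℝ E3 E3).hasFDerivAt.comp_hasDerivWithinAt t (hα t ht)
  have hγd : ∀ t ∈ Ici (0 : ℝ),
      HasDerivWithinAt (fun t => dot (α t).2 (α t).2) 0 (Ici 0) t := fun t ht => by
    convert! hasDerivWithinAt_dot (hγ t ht) (hγ t ht) using 1
    simp only [dot, PiLp.smul_apply, smul_eq_mul, directionField_apply]
    ring
  have hγ1 : ∀ t ∈ Ici (0 : ℝ), dot (α t).2 (α t).2 = 1 := fun t ht => by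
    have e1 := antitoneOn_Ici_of_hasDerivWithinAt hγd (fun _ _ => le_rfl) self_mem_Ici ht ht
    have e2 := antitoneOn_Ici_of_hasDerivWithinAt (fun t ht => (hγd t ht).neg)
      (fun _ _ => by simp) self_mem_Ici ht ht
    simp only [Pi.neg_apply] at e1 e2
    linarith
  have hvd : ∀ t ∈ Ici (0 : ℝ), HasDerivWithinAt (fun t => dot (α t).1 (α t).1)
      (χ (α t) * (2 * dot (α t).1 (velocityField g k1v k2v k1r (α t).1 (α t).2)))
      (Ici 0) t := fun t ht => by
    convert! hasDerivWithinAt_dot (hv t ht) (hv t ht) using 1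
    simp only [dot, PiLp.smul_apply, smul_eq_mul]
    ring
  -- On the boundary `|v|² = M` the field points strictly inwards: `|e3 - γ| ≤ 2`, so the linear
  -- damping beats gravity once `M > 4 g² / k1v²`.
  have hneg : ∀ v γ : E3, dot v v = M → dot γ γ = 1 →
      2 * dot v (velocityField g k1v k2v k1r v γ) < 0 := fun v γ hv hγ => by
    have e1 : dot v (velocityField g k1v k2v k1r v γ) = g * dot v (e3 - γ) - k1v * dot v v
        - k2v * (dot γ γ * dot v v - dot γ v ^ 2) := by
      simp only [dot, velocityField_apply, PiLp.sub_apply]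
      ring
    have e2 : 0 ≤ dot γ γ * dot v v - dot γ v ^ 2 := by
      have : dot γ γ * dot v v - dot γ v ^ 2 = (γ 0 * v 1 - γ 1 * v 0) ^ 2
          + (γ 1 * v 2 - γ 2 * v 1) ^ 2 + (γ 2 * v 0 - γ 0 * v 2) ^ 2 := by
        simp only [dot]
        ring
      rw [this]
      positivity
    have e3' : dot (e3 - γ) (e3 - γ) ≤ 4 := by
      have hγ2 := hγ
      simp only [dot, PiLp.sub_apply, e3_zero, e3_one, e3_two] at hγ2 ⊢
      nlinarith [sq_nonneg (γ 2 + 1), mul_self_nonneg (γ 0), mul_self_nonneg (γ 1)]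
    have e4 : 2 * (g * dot v (e3 - γ)) ≤
        k1v * dot v v + g ^ 2 / k1v * dot (e3 - γ) (e3 - γ) := by
      have : k1v * dot v v + g ^ 2 / k1v * dot (e3 - γ) (e3 - γ) - 2 * (g * dot v (e3 - γ))
          = ((k1v * v 0 - g * (e3 - γ) 0) ^ 2 + (k1v * v 1 - g * (e3 - γ) 1) ^ 2
            + (k1v * v 2 - g * (e3 - γ) 2) ^ 2) / k1v := by
        simp only [dot]
        field_simp
        ring
      have h0 : 0 ≤ ((k1v * v 0 - g * (e3 - γ) 0) ^ 2 + (k1v * v 1 - g * (e3 - γ) 1) ^ 2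
            + (k1v * v 2 - g * (e3 - γ) 2) ^ 2) / k1v := by positivity
      linarith
    have e5 : g ^ 2 / k1v * dot (e3 - γ) (e3 - γ) ≤ g ^ 2 / k1v * 4 := by gcongr
    have e6 : g ^ 2 / k1v * 4 < k1v * M := by
      rw [div_lt_iff₀ (by positivity)] at hM
      rw [div_mul_eq_mul_div, div_lt_iff₀ hk1v]
      linarith
    rw [e1]
    have := mul_nonneg hk2v.le e2
    rw [hv] at *
    linarith
  refine fun t ht => ⟨?_, hγ1 t ht⟩
  refine image_le_of_deriv_right_lt_deriv_boundary (B := fun _ => M) (B' := fun _ => 0) (b := t)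
    (fun s hs => ((hvd s hs.1).continuousWithinAt).mono Icc_subset_Ici_self)
    (fun s hs => (hvd s hs.1).mono (Ici_subset_Ici.2 hs.1)) h1
    (fun s => hasDerivAt_const s M) (fun s hs heq => ?_) ⟨ht, le_rfl⟩
  exact mul_neg_of_pos_of_neg (hχ _ heq (hγ1 s hs.1)) (hneg _ _ heq (hγ1 s hs.1))

lemma exists_trajectory {g k1v k2v k1r : ℝ} (hg : 0 < g) (hk1v : 0 < k1v) (hk2v : 0 < k2v)
    (p : ErrorState) : ∃ ξ ∈ trajectories g k1v k2v k1r, ξ 0 = p := by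
  set M := dot p.1 p.1 + 4 * g ^ 2 / k1v ^ 2 + 1 with hM
  have hp : 0 ≤ dot p.1 p.1 := by rw [← norm_sq_eq_dot]; positivity
  have hM0 : 0 ≤ 4 * g ^ 2 / k1v ^ 2 := by positivity
  -- The cutoff equals `1` on the invariant set `|v|² ≤ M`, `|γ| = 1`, since `|x|² ≤ M` implies `|x|
  -- ≤ M + 1`; there the truncated and the original field agree.
  let χ : ContDiffBump (0 : E3 × E3) := ⟨M + 1, M + 2, by linarith, by linarith⟩
  have hχ : ∀ x : E3 × E3, dot x.1 x.1 ≤ M → dot x.2 x.2 = 1 → χ x = 1 := fun x h1 h2 => by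
    refine χ.one_of_mem_closedBall ?_
    rw [mem_closedBall_zero_iff, Prod.norm_def]
    rw [← norm_sq_eq_dot] at h1 h2
    refine max_le ?_ ?_
    · change ‖x.1‖ ≤ M + 1
      nlinarith [sq_nonneg (‖x.1‖ - 1), norm_nonneg x.1]
    · change ‖x.2‖ ≤ M + 1
      nlinarith [sq_nonneg (‖x.2‖ - 1), norm_nonneg x.2]
  obtain ⟨α, hα0, hα⟩ := exists_solution_Ici_of_hasCompactSupport
    (F := fun x => χ x • errorField g k1v k2v k1r x)
    (χ.contDiff.smul (contDiff_errorField g k1v k2v k1r)) χ.hasCompactSupport.smul_right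
    (p.1, (p.2 : E3))
  have hbd := velocity_sq_le_of_solution (k1r := k1r) (M := M) hg hk1v hk2v (by linarith)
    (fun x h1 h2 => by rw [hχ x h1.le h2]; exact one_pos) hα (by rw [hα0]; linarith)
    (by rw [hα0]; exact dot_self_sphere p.2)
  have hsph : ∀ t ∈ Ici (0 : ℝ), (α t).2 ∈ Metric.sphere (0 : E3) 1 := fun t ht => by
    have h1 := (hbd t ht).2
    rw [← norm_sq_eq_dot] at h1
    rw [mem_sphere_zero_iff_norm]
    exact (pow_eq_one_iff_of_nonneg (norm_nonneg _) two_ne_zero).1 h1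
  have hα' : ∀ t ∈ Ici (0 : ℝ),
      HasDerivWithinAt α (errorField g k1v k2v k1r (α t)) (Ici 0) t := fun t ht => by
    simpa only [hχ _ (hbd t ht).1 (hbd t ht).2, one_smul] using hα t ht
  classical
  -- At negative times `α` may leave the sphere; `p.2` is then a harmless default.
  let ξ : ℝ → ErrorState := fun t =>
    ((α t).1, if h : (α t).2 ∈ Metric.sphere (0 : E3) 1 then ⟨(α t).2, h⟩ else p.2)
  have hξ : ∀ t ∈ Ici (0 : ℝ), ((ξ t).2 : E3) = (α t).2 := fun t ht => by
    simp only [ξ, dif_pos (hsph t ht)]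
  refine ⟨ξ, fun t ht => ⟨?_, ?_⟩, Prod.ext ?_ (Subtype.ext ?_)⟩
  · rw [hξ t ht]
    exact (ContinuousLinearMap.fst ℝ E3 E3).hasFDerivAt.comp_hasDerivWithinAt t (hα' t ht)
  · rw [hξ t ht]
    exact HasDerivWithinAt.congr_of_mem
      ((ContinuousLinearMap.snd ℝ E3 E3).hasFDerivAt.comp_hasDerivWithinAt t (hα' t ht)) hξ ht
  · simp only [ξ, hα0]
  · rw [hξ 0 self_mem_Ici, hα0]

lemma IsSolutionOn.hasDerivWithinAt {g k1v k2v k1r : ℝ} {I : Set ℝ} {ξ : ℝ → ErrorState}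
    (h : IsSolutionOn g k1v k2v k1r I ξ) {t : ℝ} (ht : t ∈ I) :
    HasDerivWithinAt (fun t => ((ξ t).1, ((ξ t).2 : E3)))
      (errorField g k1v k2v k1r ((ξ t).1, ((ξ t).2 : E3))) I t :=
  (h t ht).1.prodMk (h t ht).2

lemma IsSolutionOn.eqOn {g k1v k2v k1r T : ℝ} {ξ ζ : ℝ → ErrorState}
    (hζ : IsSolutionOn g k1v k2v k1r (Icc 0 T) ζ) (hξ : ξ ∈ trajectories g k1v k2v k1r)
    (h0 : ζ 0 = ξ 0) : EqOn ζ ξ (Icc 0 T) := by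
  have h := eqOn_Icc_of_contDiff (contDiff_errorField g k1v k2v k1r)
    (fun t ht => hζ.hasDerivWithinAt ht)
    (fun t ht => (IsSolutionOn.hasDerivWithinAt hξ ht.1).mono Icc_subset_Ici_self)
    (by simp only [h0])
  intro t ht
  have := Prod.ext_iff.1 (h ht)
  exact Prod.ext this.1 (Subtype.ext this.2)

end GammaObserver

namespace GammaObserver

/-! ### Asymptotic behaviour -/

section

variable {g k1v k2v k1r : ℝ}

lemma tendsto_of_dist_sq_tendsto {X : Type*} [PseudoMetricSpace X] {f : ℝ → X} {x : X}
    (h : Tendsto (fun t => dist (f t) x ^ 2) atTop (𝓝 0)) : Tendsto f atTop (𝓝 x) := by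
  rw [tendsto_iff_dist_tendsto_zero]
  have := (Real.continuous_sqrt.tendsto 0).comp h
  rw [Real.sqrt_zero] at this
  refine this.congr fun t => ?_
  simp [Real.sqrt_sq dist_nonneg]

variable (hg : 0 < g) (hk1v : 0 < k1v) (hk2v : 0 < k2v) (hk1r : 0 < k1r)
include hg hk1v hk2v hk1r

/-- Treats both equilibria at once: `W` and `z` vanish in the limit, so `v` tends to `s γ`, and `b`
is the limit of `s c`. -/
lemma tendsto_velocity {ξ : ℝ → ErrorState} (hξ : ξ ∈ trajectories g k1v k2v k1r) {a b : ℝ}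
    (ha : a ^ 2 = 1) (hc : Tendsto (fun t => height (ξ t)) atTop (𝓝 a))
    (hb : -(g * (1 - a) / k1v) * a = b) : Tendsto (fun t => (ξ t).1) atTop (𝓝 (b • e3)) := by
  have h := isReducedSolution hξ
  have hK : 0 < k1v + k2v := add_pos hk1v hk2v
  refine tendsto_of_dist_sq_tendsto ?_
  have hs := h.tendsto_axial hk1v hc
  have := (((h.tendsto_planar hg hK hk1r).add (hs.pow 2)).sub
    (((h.tendsto_climb hg hK hk1r).add (hs.mul hc)).const_mul (2 * b))).add_const (b ^ 2)
  convert! this using 1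
  · ext t
    exact dist_velocity_sq (ξ t) b
  · congr 1
    rw [hb, ← hb]
    linear_combination (g * (1 - a) / k1v) ^ 2 * ha

lemma tendsto_desired {ξ : ℝ → ErrorState} (hξ : ξ ∈ trajectories g k1v k2v k1r)
    (hc : Tendsto (fun t => height (ξ t)) atTop (𝓝 1)) : Tendsto ξ atTop (𝓝 desired) := by
  have h1 := tendsto_velocity hg hk1v hk2v hk1r hξ (one_pow 2) hc (b := 0) (by simp)
  rw [zero_smul] at h1
  refine h1.prodMk_nhds (tendsto_of_dist_sq_tendsto ?_)
  simp only [dist_direction_desired_sq]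
  simpa using (hc.const_sub 1).const_mul 2

lemma tendsto_undesired {ξ : ℝ → ErrorState} (hξ : ξ ∈ trajectories g k1v k2v k1r)
    (hc : Tendsto (fun t => height (ξ t)) atTop (𝓝 (-1))) :
    Tendsto ξ atTop (𝓝 (undesired g k1v)) := by
  have h1 := tendsto_velocity hg hk1v hk2v hk1r hξ (by norm_num) hc (b := 2 * g / k1v) (by ring)
  refine h1.prodMk_nhds (tendsto_of_dist_sq_tendsto ?_)
  simp only [dist_direction_undesired_sq]
  simpa using (hc.const_add 1).const_mul 2

lemma tendsto_desired_or_undesired {ξ : ℝ → ErrorState} (hξ : ξ ∈ trajectories g k1v k2v k1r) :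
    Tendsto ξ atTop (𝓝 desired) ∨ Tendsto ξ atTop (𝓝 (undesired g k1v)) :=
  ((isReducedSolution hξ).tendsto_height hg (add_pos hk1v hk2v) hk1r).imp
    (tendsto_desired hg hk1v hk2v hk1r hξ) (tendsto_undesired hg hk1v hk2v hk1r hξ)

lemma isLocallyExponentiallyStable_desired :
    IsLocallyExponentiallyStable (trajectories g k1v k2v k1r) desired := by
  obtain ⟨C, hC, ρ, hρ, H⟩ := exists_exponential_decay hg hk1v (add_pos hk1v hk2v) hk1r
  -- Square roots, because the decay estimate concerns squared distances; the `2` is the cost of the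
  -- sup distance. The radius ensures `E ≤ (k1r + g) d² < g`.
  refine ⟨√(2 * C), by positivity, ρ / 2, by positivity, √(g / (k1r + g)), by positivity,
    fun ξ hξ h0 t ht => ?_⟩
  have h := isReducedSolution hξ
  have hd : dist (ξ 0) desired ^ 2 < g / (k1r + g) := by
    rwa [← Real.lt_sqrt dist_nonneg]
  have hle := le_dist_desired_sq (ξ 0)
  have hE : k1r / 2 * planarVelocitySq (ξ 0) + g * (1 - height (ξ 0)) < g := by
    rw [lt_div_iff₀ (by positivity)] at hd
    have hW : 0 ≤ planarVelocitySq (ξ 0) := h.planar_nonneg 0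
    have hV : 0 ≤ 1 - height (ξ 0) := sub_nonneg.2 (h.height_le 0)
    have e1 : k1r / 2 * planarVelocitySq (ξ 0) ≤ k1r * dist (ξ 0) desired ^ 2 := by
      have := sq_nonneg (axialVelocity (ξ 0))
      calc k1r / 2 * planarVelocitySq (ξ 0) ≤ k1r / 2 * (2 * dist (ξ 0) desired ^ 2) := by
            gcongr; linarith
        _ = _ := by ring
    have e2 : g * (1 - height (ξ 0)) ≤ g * dist (ξ 0) desired ^ 2 := by
      have := sq_nonneg (axialVelocity (ξ 0))
      gcongr
      linarith
    linarith
  have h2 := H _ _ _ _ _ h hE t ht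
  have h3 := dist_desired_sq_le (ξ t) (h.planar_nonneg t)
  refine abs_le_of_sq_le_sq' ?_ (by positivity) |>.2
  calc dist (ξ t) desired ^ 2 ≤ C * Real.exp (-ρ * t) * (2 * dist (ξ 0) desired ^ 2) := by
        refine (h3.trans h2).trans ?_
        gcongr
    _ = _ := by
        rw [mul_pow, mul_pow, Real.sq_sqrt (by positivity), ← Real.exp_nat_mul]
        push_cast
        ring_nf

lemma isStable_desired : IsStable (trajectories g k1v k2v k1r) desired := by
  obtain ⟨C, hC, r, hr, δ, hδ, H⟩ := isLocallyExponentiallyStable_desired hg hk1v hk2v hk1r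
  refine fun ε hε => ⟨min δ (ε / C), by positivity, fun ξ hξ h0 t ht => ?_⟩
  have h1 : dist (ξ 0) desired < ε / C := h0.trans_le (min_le_right _ _)
  rw [lt_div_iff₀ hC] at h1
  calc dist (ξ t) desired ≤ C * Real.exp (-r * t) * dist (ξ 0) desired :=
        H ξ hξ (h0.trans_le (min_le_left _ _)) t ht
    _ ≤ C * 1 * dist (ξ 0) desired := by
        gcongr
        rw [Real.exp_le_one_iff]
        nlinarith
    _ < ε := by linarith

lemma basin_desired_mem_nhds : basin (trajectories g k1v k2v k1r) desired ∈ 𝓝 desired := by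
  obtain ⟨C, hC, r, hr, δ, hδ, H⟩ := isLocallyExponentiallyStable_desired hg hk1v hk2v hk1r
  refine mem_of_superset (Metric.ball_mem_nhds _ hδ) fun p hp => ?_
  obtain ⟨ξ, hξ, rfl⟩ := exists_trajectory (k1r := k1r) hg hk1v hk2v p
  refine ⟨ξ, hξ, rfl, tendsto_iff_dist_tendsto_zero.2 ?_⟩
  have hlim : Tendsto (fun t => C * Real.exp (-r * t) * dist (ξ 0) desired) atTop (𝓝 0) := by
    have : Tendsto (fun t => -r * t) atTop atBot :=
      tendsto_id.const_mul_atTop_of_neg (by linarith)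
    simpa using ((Real.tendsto_exp_atBot.comp this).const_mul C).mul_const (dist (ξ 0) desired)
  refine squeeze_zero' (Eventually.of_forall fun _ => dist_nonneg) ?_ hlim
  filter_upwards [eventually_ge_atTop 0] with t ht using H ξ hξ hp t ht

lemma compl_basin_subset : (basin (trajectories g k1v k2v k1r) desired)ᶜ ⊆ {p | spin p = 0} := by
  intro p hp
  obtain ⟨ξ, hξ, rfl⟩ := exists_trajectory (k1r := k1r) hg hk1v hk2v p
  have hK : 0 < k1v + k2v := add_pos hk1v hk2v
  rcases (isReducedSolution hξ).tendsto_height hg hK hk1r with hc | hc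
  · exact absurd ⟨ξ, hξ, rfl, tendsto_desired hg hk1v hk2v hk1r hξ hc⟩ hp
  · exact (isReducedSolution hξ).spin_eq_zero hg hK hk1r hc

omit hg hk1v hk2v hk1r in
-- Tilting `γ` slightly from `-e3` while keeping `v = -(2 g / k1v) γ` leaves no planar velocity and
-- lowers the energy below `2 g`.
lemma exists_dist_undesired_lt {δ : ℝ} (hδ : 0 < δ) :
    ∃ p : ErrorState, dist p (undesired g k1v) < δ ∧ planarVelocitySq p = 0 ∧ -1 < height p := by
  have hmem : ∀ θ : ℝ, (!₂[Real.sin θ, 0, -Real.cos θ] : E3) ∈ Metric.sphere (0 : E3) 1 :=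
    fun θ => by
      rw [mem_sphere_zero_iff_norm, ← pow_eq_one_iff_of_nonneg (norm_nonneg _) two_ne_zero,
        norm_sq_eq_dot]
      simp only [dot, Matrix.cons_val]
      linarith [Real.sin_sq_add_cos_sq θ]
  let q : ℝ → ErrorState := fun θ =>
    (-(2 * g / k1v) • !₂[Real.sin θ, 0, -Real.cos θ], ⟨!₂[Real.sin θ, 0, -Real.cos θ], hmem θ⟩)
  have hcont : Continuous fun θ : ℝ => (!₂[Real.sin θ, 0, -Real.cos θ] : E3) := by
    refine (PiLp.continuous_toLp 2 _).comp (continuous_pi fun i => ?_)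
    fin_cases i
    · exact Real.continuous_sin
    · exact continuous_const
    · exact Real.continuous_cos.neg
  have hq : Continuous q := (hcont.const_smul (-(2 * g / k1v))).prodMk (hcont.subtype_mk hmem)
  have hq0 : q 0 = undesired g k1v := by
    refine Prod.ext ?_ (Subtype.ext ?_) <;> ext i <;> fin_cases i <;>
      simp [q, undesired, e3S, e3_zero, e3_one, e3_two]
  have hnear : ∀ᶠ θ in 𝓝[>] (0 : ℝ), dist (q θ) (undesired g k1v) < δ :=
    ((hq.tendsto' 0 _ hq0).mono_left nhdsWithin_le_nhds).eventually (Metric.ball_mem_nhds _ hδ)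
  obtain ⟨θ, hθ, hθ0⟩ := (hnear.and (Ioo_mem_nhdsGT Real.pi_pos)).exists
  refine ⟨q θ, hθ, ?_, ?_⟩
  · have h1 : Real.cos θ ^ 2 = 1 - Real.sin θ ^ 2 := Real.cos_sq' θ
    simp only [q, planarVelocitySq, axialVelocity, dot, PiLp.smul_apply,
      Matrix.cons_val, smul_eq_mul]
    linear_combination -(2 * g / k1v) ^ 2 * (Real.sin θ ^ 2 + Real.cos θ ^ 2) * h1
  · have h1 := Real.cos_lt_cos_of_nonneg_of_le_pi le_rfl hθ0.2.le hθ0.1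
    rw [Real.cos_zero] at h1
    simp only [q, height, Matrix.cons_val]
    linarith

/-- The energy starts below `2 g` and does not increase, which excludes `c → -1`. The other limit is
at distance at least `2` from the undesired equilibrium, so `ε = 1` fails. -/
lemma not_isStable_undesired :
    ¬ IsStable (trajectories g k1v k2v k1r) (undesired g k1v) := by
  intro hst
  obtain ⟨δ, hδ, H⟩ := hst 1 one_pos
  obtain ⟨p, hp, hW, hc⟩ := exists_dist_undesired_lt (g := g) (k1v := k1v) hδ
  obtain ⟨ξ, hξ, rfl⟩ := exists_trajectory (k1r := k1r) hg hk1v hk2v p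
  have hK : 0 < k1v + k2v := add_pos hk1v hk2v
  have h := isReducedSolution hξ
  rcases h.tendsto_height hg hK hk1r with hlim | hlim
  · have hd : dist desired (undesired g k1v) ≤ 1 :=
      le_of_tendsto ((tendsto_desired hg hk1v hk2v hk1r hξ hlim).dist tendsto_const_nhds)
        ((eventually_ge_atTop 0).mono fun t ht => (H ξ hξ hp t ht).le)
    have h1 : dist e3S (-e3S) ≤ 1 := (le_max_right _ _).trans hd
    have h2 := dist_direction_undesired_sq desired
    simp only [desired, height, e3S, e3_two] at h1 h2
    have h3 := pow_le_one₀ (n := 2) dist_nonneg h1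
    linarith
  · have hle : (2 : ℝ) ≤ 1 - height (ξ 0) := by
      have := le_of_tendsto (((hlim.const_sub 1).const_mul g).congr fun _ => rfl)
        ((eventually_ge_atTop 0).mono fun t ht => by
          have h1 := h.energy_antitoneOn hK hk1r self_mem_Ici ht ht
          have h2 := mul_nonneg (half_pos hk1r).le (h.planar_nonneg t)
          simp only [hW] at h1
          show g * (1 - height (ξ t)) ≤ g * (1 - height (ξ 0))
          linarith)
      have := le_of_mul_le_mul_left this hg
      linarith
    linarith

end

/-! ### The exceptional set -/

lemma continuous_coord (i : Fin 3) : Continuous fun u : E3 => u i :=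
  (EuclideanSpace.proj (𝕜 := ℝ) i).continuous

lemma continuous_spin : Continuous spin := by
  have h1 : ∀ i, Continuous fun p : ErrorState => p.1 i := fun i =>
    (continuous_coord i).comp continuous_fst
  have h2 : ∀ i, Continuous fun p : ErrorState => (p.2 : E3) i := fun i =>
    (continuous_coord i).comp (continuous_subtype_val.comp continuous_snd)
  exact ((h2 0).mul (h1 1)).sub ((h2 1).mul (h1 0))

lemma volume_ker_eq_zero {ℓ : E3 →ₗ[ℝ] ℝ} (hℓ : ℓ ≠ 0) :
    (volume : Measure E3) {x | ℓ x = 0} = 0 :=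
  Measure.addHaar_submodule volume (LinearMap.ker ℓ) fun h => hℓ (LinearMap.ker_eq_top.1 h)

/-- Great circles have surface measure zero. -/
lemma toSphere_ker_eq_zero {ℓ : E3 →ₗ[ℝ] ℝ} (hℓ : ℓ ≠ 0) :
    (volume : Measure E3).toSphere {γ | ℓ (γ : E3) = 0} = 0 := by
  have hm : MeasurableSet {γ : S2 | ℓ (γ : E3) = 0} :=
    (isClosed_singleton.preimage
      (ℓ.continuous_of_finiteDimensional.comp continuous_subtype_val)).measurableSet
  rw [Measure.toSphere_apply' _ hm]
  refine mul_eq_zero_of_right _ (measure_mono_null ?_ (volume_ker_eq_zero hℓ))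
  -- The surface measure is defined through the cone over the set, which here lies in a plane.
  rintro _ ⟨a, -, _, ⟨γ, hγ, rfl⟩, rfl⟩
  have h : ℓ (γ : E3) = 0 := hγ
  change ℓ (a • (γ : E3)) = 0
  rw [map_smul, h, smul_zero]

/-- Fubini over `v`: whenever `v 0 ≠ 0`, the spin is a nonzero linear form in `γ`, so the slice is a
great circle. -/
lemma stateMeasure_spin_eq_zero : stateMeasure {p | spin p = 0} = 0 := by
  have hm : MeasurableSet {p : ErrorState | spin p = 0} :=
    (isClosed_singleton.preimage continuous_spin).measurableSet
  rw [stateMeasure, Measure.measure_prod_null hm]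
  have hne : (EuclideanSpace.proj (𝕜 := ℝ) (0 : Fin 3) : E3 →L[ℝ] ℝ).toLinearMap ≠ 0 := fun h => by
    have := LinearMap.congr_fun h (EuclideanSpace.single 0 1)
    simp at this
  have hae : ∀ᵐ v : E3, v 0 ≠ 0 := by
    rw [ae_iff]
    simpa using volume_ker_eq_zero hne
  filter_upwards [hae] with v hv
  let ℓ : E3 →L[ℝ] ℝ := v 1 • EuclideanSpace.proj (0 : Fin 3) - v 0 • EuclideanSpace.proj 1
  have hℓ : ℓ.toLinearMap ≠ 0 := fun h => by
    have := LinearMap.congr_fun h (EuclideanSpace.single 1 1)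
    simp [ℓ, hv] at this
  have := toSphere_ker_eq_zero hℓ
  convert! this using 2
  ext γ
  simp [spin, ℓ, mul_comm]

end GammaObserver

theorem proposition2 (g k1v k2v k1r : ℝ) (hg : 0 < g) (hk1v : 0 < k1v) (hk2v : 0 < k2v)
    (hk1r : 0 < k1r) :
    -- exactly two equilibria, both isolated
    (GammaObserver.equilibria g k1v k2v k1r =
        {GammaObserver.desired, GammaObserver.undesired g k1v} ∧
      GammaObserver.desired ≠ GammaObserver.undesired g k1v ∧
      ∀ p ∈ GammaObserver.equilibria g k1v k2v k1r,
        ∃ U ∈ 𝓝 p, U ∩ GammaObserver.equilibria g k1v k2v k1r = {p}) ∧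
    -- every initial condition has exactly one trajectory, which is defined for all
    -- nonnegative times and converges to one of the two equilibria
    (∀ p : GammaObserver.ErrorState,
      ∃ ξ ∈ GammaObserver.trajectories g k1v k2v k1r, ξ 0 = p ∧
        (∀ T > 0, ∀ ζ : ℝ → GammaObserver.ErrorState,
          GammaObserver.IsSolutionOn g k1v k2v k1r (Icc 0 T) ζ → ζ 0 = p →
            EqOn ζ ξ (Icc 0 T)) ∧
        (Tendsto ξ atTop (𝓝 GammaObserver.desired) ∨
          Tendsto ξ atTop (𝓝 (GammaObserver.undesired g k1v)))) ∧
    -- stability of the desired equilibrium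
    (GammaObserver.IsAlmostGloballyAsymptoticallyStable GammaObserver.stateMeasure
        (GammaObserver.trajectories g k1v k2v k1r) GammaObserver.desired ∧
      GammaObserver.IsLocallyExponentiallyStable
        (GammaObserver.trajectories g k1v k2v k1r) GammaObserver.desired) ∧
    -- instability of the undesired equilibrium
    ¬ GammaObserver.IsStable
        (GammaObserver.trajectories g k1v k2v k1r) (GammaObserver.undesired g k1v) := by
  open GammaObserver in
  refine ⟨⟨equilibria_eq hg hk1v hk1r, desired_ne_undesired g k1v, fun p hp => ?_⟩, fun p => ?_,
    ⟨⟨⟨isStable_desired hg hk1v hk2v hk1r, basin_desired_mem_nhds hg hk1v hk2v hk1r⟩,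
      measure_mono_null (compl_basin_subset hg hk1v hk2v hk1r) stateMeasure_spin_eq_zero⟩,
      isLocallyExponentiallyStable_desired hg hk1v hk2v hk1r⟩,
    not_isStable_undesired hg hk1v hk2v hk1r⟩
  · have hfin : (equilibria g k1v k2v k1r).Finite := by
      rw [equilibria_eq hg hk1v hk1r]; exact toFinite _
    -- The other equilibria form a finite, hence closed, set; its complement isolates `p`.
    refine ⟨(equilibria g k1v k2v k1r \ {p})ᶜ,
      (hfin.subset sdiff_subset).isClosed.isOpen_compl.mem_nhds (by simp), ?_⟩
    ext q
    by_cases hq : q = p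
    · simp [hq, hp]
    · simp [hq]
  · obtain ⟨ξ, hξ, h0⟩ := exists_trajectory (k1r := k1r) hg hk1v hk2v p
    exact ⟨ξ, hξ, h0, fun T _ ζ hζ hζ0 => hζ.eqOn hξ (hζ0.trans h0.symm),
      tendsto_desired_or_undesired hg hk1v hk2v hk1r hξ⟩
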